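/- \textbf{Theorem (Spherical Green Formulas I).} Let $\Omega=\{\xi\in\mathbb{R}^3:|\xi|=1\}$ be the unit sphere, and let $\Gamma\subset\Omega$ be a regular region, i.e., a non-empty connected open subset of $\Omega$ whose boundary $\partial\Gamma$ consists of finitely many pairwise disjoint simple closed curves of class $C^1$ with $\Gamma$ lying locally on exactly one side of them (the case $\Gamma=\Omega$, $\partial\Gamma=\emptyset$ is allowed; the boundary integrals then vanish). For $\eta\in\partial\Gamma$ let $\nu(\eta)$ be the unit vector that is tangential to $\Omega$, perpendicular to $\partial\Gamma$ and points into the exterior of $\Gamma$, and let $\tau(\eta)=\eta\wedge\nu(\eta)$ be the positively oriented unit tangential vector of $\partial\Gamma$. Let $d\omega$ be the surface element on $\Omega$ and $d\sigma$ the line element on $\partial\Gamma$. With $r=|x|$ and $\xi=x/|x|$, the surface gradient $\nabla^*$ and the Beltrami operator $\Delta^*$ are given by $$\nabla_x=\xi\frac{\partial}{\partial r}+\frac1r\nabla^*_\xi,\qquad \Delta_x=\frac1{r^2}\frac{\partial}{\partial r}r^2\frac{\partial}{\partial r}+\frac1{r^2}\Delta^*_\xi ,$$ the surface curl gradient is ${\rm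 L}^*=\xi\wedge\nabla^*_\xi$, and for a vector field $f=(f_1,f_2,f_3)$ one sets $\nabla^*\cdot f=\sum_{j=1}^3(\nabla^*f_j)_j$ and ${\rm L}^*\cdot f=\sum_{j=1}^3({\rm L}^*f_j)_j$. The normal derivative is $\frac{\partial}{\partial\nu}F=\nu\cdot\nabla^*F$. A function is of class $C^{k}(\overline\Gamma)$ (for vector fields $\overline\Gamma\to\mathbb{R}^3$: $c^{k}(\overline\Gamma)$) if it is $k$ times continuously differentiable up to the boundary. (a) If $f$ is of class $c^{1}(\overline\Gamma)$ and tangential, i.e., $\xi\cdot f(\xi)=0$ for all $\xi\in\overline\Gamma$, then $$\int_\Gamma\nabla^*\cdot f\,d\omega=\int_{\partial\Gamma}\nu\cdot f\,d\sigma,\qquad \int_\Gamma{\rm L}^*\cdot f\,d\omega=\int_{\partial\Gamma}\tau\cdot f\,d\sigma .$$ (b) If $F$ is of class $C^{1}(\overline\Gamma)$ and $f$ of class $c^{1}(\overline\Gamma)$ (not necessarily tangential), then $$\int_\Gamma f\cdot\nabla^*F\,d\omega+\int_\Gamma F\,\nabla^*\cdot f\,d\omega=\int_{\partial\Gamma}\nu\cdot(Ff)\,d\sigma+2\int_\Gamma\eta\cdot\big(F(\eta)f(\eta)\big)\,d\omega(\eta),$$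 $$\int_\Gamma f\cdot{\rm L}^*F\,d\omega+\int_\Gamma F\,{\rm L}^*\cdot f\,d\omega=\int_{\partial\Gamma}\tau\cdot(Ff)\,d\sigma .$$ (c) If $F,H$ are of class $C^{2}(\overline\Gamma)$, then $$\int_\Gamma F\,\Delta^*H\,d\omega-\int_\Gamma H\,\Delta^*F\,d\omega=\int_{\partial\Gamma}F\,\frac{\partial H}{\partial\nu}\,d\sigma-\int_{\partial\Gamma}H\,\frac{\partial F}{\partial\nu}\,d\sigma .$$ -/

import Mathlib

open MeasureTheory Set Filter Topology
open scoped Manifold ContDiff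

/-- Euclidean three-space. -/
abbrev E3 : Type := EuclideanSpace ℝ (Fin 3)

/-- The unit sphere of `ℝ³`, with Mathlib's topology and smooth structure. -/
abbrev S2 : Type := Metric.sphere (0 : E3) 1

namespace Spherical

/-- The vector product of `ℝ³`. -/
def cross (a b : E3) : E3 := WithLp.toLp 2 (crossProduct a.ofLp b.ofLp)

/-- An arbitrary point of the sphere, used only as the value of `radialProj` at the origin. -/
noncomputable def basePoint : S2 := ⟨EuclideanSpace.single 0 1, by simp⟩

open Classical in
/-- The radial projection `x ↦ x / |x|` of `ℝ³ \ {0}` onto the unit sphere. -/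
noncomputable def radialProj (x : E3) : S2 :=
  if h : x = 0 then basePoint else
    ⟨(‖x‖)⁻¹ • x, by simp [norm_smul, h]⟩

/-- The cone `{x ≠ 0 : x / |x| ∈ A}` over a set `A` of the sphere. -/
def cone (A : Set S2) : Set E3 := {x | x ≠ 0 ∧ radialProj x ∈ A}

/-- The extension `x ↦ F (x / |x|)` of a function on the sphere that is constant along rays. -/
noncomputable def radialExt (F : S2 → ℝ) (x : E3) : ℝ := F (radialProj x)

/-- The surface gradient `∇*F`, the tangential part in `∇ = ξ ∂/∂r + (1/r) ∇*`. On a function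
that is constant along rays the radial part vanishes, so that `∇*F (ξ)` is the Euclidean gradient
at `ξ` (where `r = 1`) of the radial extension. `A` is the set on which `F` is given; for
`A = closure Γ` the derivative is the ordinary one at the points of an open set `Γ` and the
one-sided one on its boundary. -/
noncomputable def surfGrad (A : Set S2) (F : S2 → ℝ) (ξ : S2) : E3 :=
  gradientWithin (radialExt F) (cone A) (ξ : E3)

/-- The surface curl gradient `L*F = ξ ∧ ∇*F`. -/
noncomputable def surfCurlGrad (A : Set S2) (F : S2 → ℝ) (ξ : S2) : E3 :=
  cross (ξ : E3) (surfGrad A F ξ)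

/-- The surface divergence `∇* · f`: the Euclidean inner product of the vector operator `∇*`
with the Cartesian components of `f`. -/
noncomputable def surfDiv (A : Set S2) (f : S2 → E3) (ξ : S2) : ℝ :=
  ∑ j : Fin 3, surfGrad A (fun η => f η j) ξ j

/-- The surface curl `L* · f`: the Euclidean inner product of the vector operator `L*`
with the Cartesian components of `f`. -/
noncomputable def surfCurl (A : Set S2) (f : S2 → E3) (ξ : S2) : ℝ :=
  ∑ j : Fin 3, surfCurlGrad A (fun η => f η j) ξ j

/-- The Beltrami operator `Δ*`, the tangential part in
`Δ = r⁻² ∂/∂r (r² ∂/∂r) + r⁻² Δ*`: at `r = 1`, the Laplacian of the radial extension. -/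
noncomputable def beltrami (A : Set S2) (F : S2 → ℝ) (ξ : S2) : ℝ :=
  InnerProductSpace.laplacianWithin (radialExt F) (cone A) (ξ : E3)

/-- The surface element `dω` of the unit sphere (total mass `4π`). -/
noncomputable def surfaceMeasure : Measure S2 := (volume : Measure E3).toSphere

/-- A scalar function of class `C^k` on the set `A` of the sphere. -/
def IsCk (k : ℕ) (A : Set S2) (F : S2 → ℝ) : Prop :=
  ContMDiffOn (𝓡 2) 𝓘(ℝ, ℝ) k F A

/-- A vector field with values in `ℝ³` of class `c^k` on the set `A` of the sphere. -/
def IsVecCk (k : ℕ) (A : Set S2) (f : S2 → E3) : Prop :=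
  ContMDiffOn (𝓡 2) 𝓘(ℝ, E3) k f A

/-- A regular region: a subdomain `Γ` of the unit sphere whose boundary consists of finitely many
pairwise disjoint simple closed `C¹` curves, parametrized by arc length and positively oriented,
that is, the unit vector `ν = γ' ∧ γ`, which is tangential to the sphere and perpendicular to the
curve (and for which `γ ∧ ν = γ'`), points out of `Γ`. -/
structure RegularRegion where
  /-- the region -/
  Γ : Set S2
  isOpen : IsOpen Γ
  isConnected : IsConnected Γ
  /-- the number of boundary curves -/
  n : ℕ
  /-- the boundary curves -/
  γ : Fin n → ℝ → S2
  /-- their lengths -/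
  len : Fin n → ℝ
  len_pos : ∀ i, 0 < len i
  contDiff : ∀ i, ContDiff ℝ 1 (fun s => (γ i s : E3))
  unit_speed : ∀ i s, ‖deriv (fun t => (γ i t : E3)) s‖ = 1
  periodic : ∀ i, Function.Periodic (γ i) (len i)
  injOn : ∀ i, InjOn (γ i) (Ico 0 (len i))
  disjoint : ∀ i j, i ≠ j → Disjoint (range (γ i)) (range (γ j))
  frontier_eq : frontier Γ = ⋃ i, range (γ i)
  inside : ∀ i s, ∀ᶠ t : ℝ in 𝓝[>] 0,
    radialProj ((γ i s : E3) - t • cross (deriv (fun u => (γ i u : E3)) s) (γ i s : E3)) ∈ Γ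
  outside : ∀ i s, ∀ᶠ t : ℝ in 𝓝[>] 0,
    radialProj ((γ i s : E3) + t • cross (deriv (fun u => (γ i u : E3)) s) (γ i s : E3))
      ∉ closure Γ

namespace RegularRegion

open Classical in
/-- The positively oriented unit tangential vector `τ` on the boundary (zero elsewhere); by
`tangent_apply` below it does not depend on the parameter that is chosen. -/
noncomputable def tangent (R : RegularRegion) (η : S2) : E3 :=
  if h : ∃ p : Fin R.n × ℝ, R.γ p.1 p.2 = η then
    deriv (fun s => (R.γ h.choose.1 s : E3)) h.choose.2
  else 0

/-- The unit normal vector `ν = τ ∧ η` that points into the exterior of the region. -/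
noncomputable def normal (R : RegularRegion) (η : S2) : E3 := cross (R.tangent η) (η : E3)

/-- The line element `dσ` of the boundary curve: arc length on every boundary curve. -/
noncomputable def lineMeasure (R : RegularRegion) : Measure S2 :=
  ∑ i, (volume.restrict (Ioc 0 (R.len i))).map (R.γ i)

/-- The normal derivative `∂F/∂ν = ν · ∇*F`. -/
noncomputable def normalDeriv (R : RegularRegion) (F : S2 → ℝ) (η : S2) : ℝ :=
  inner ℝ (R.normal η) (surfGrad (closure R.Γ) F η)

theorem tangent_apply (R : RegularRegion) (i : Fin R.n) (s : ℝ) :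
    R.tangent (R.γ i s) = deriv (fun t => (R.γ i t : E3)) s := by
  have key : ∀ (j : Fin R.n) (u : ℝ), R.γ j u = R.γ i s →
      deriv (fun t => (R.γ j t : E3)) u = deriv (fun t => (R.γ i t : E3)) s := by
    intro j u hu
    have hij : j = i := by
      by_contra hne
      exact Set.disjoint_left.1 (R.disjoint j i hne) ⟨u, rfl⟩ ⟨s, hu.symm⟩
    subst hij
    have hL := R.len_pos j
    have hper : Function.Periodic (fun t => (R.γ j t : E3)) (R.len j) := fun t => by
      simp only [R.periodic j t]
    have hderiv : Function.Periodic (deriv (fun t => (R.γ j t : E3))) (R.len j) := fun t => by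
      rw [← deriv_comp_add_const]
      congr 1
      funext x
      exact hper x
    obtain ⟨a, ha, hae⟩ : ∃ a ∈ Ico 0 (R.len j), ∃ m : ℤ, u - m • R.len j = a :=
      ⟨_, toIcoMod_mem_Ico' hL u, toIcoDiv hL 0 u, rfl⟩
    obtain ⟨b, hb, hbe⟩ : ∃ b ∈ Ico 0 (R.len j), ∃ m : ℤ, s - m • R.len j = b :=
      ⟨_, toIcoMod_mem_Ico' hL s, toIcoDiv hL 0 s, rfl⟩
    obtain ⟨m, rfl⟩ := hae
    obtain ⟨k, rfl⟩ := hbe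
    have hab := R.injOn j ha hb (by
      rw [(R.periodic j).sub_zsmul_eq m, (R.periodic j).sub_zsmul_eq k, hu])
    rw [← hderiv.sub_zsmul_eq m, hab, hderiv.sub_zsmul_eq k]
  have h : ∃ p : Fin R.n × ℝ, R.γ p.1 p.2 = R.γ i s := ⟨(i, s), rfl⟩
  rw [tangent, dif_pos h]
  exact key _ _ h.choose_spec

end RegularRegion

end Spherical

/-! Everything is deduced from a divergence theorem in `ℝ³` for the cone over `Γ`. Extending `F` to
be constant along rays turns `∇*F` into a Euclidean gradient at `|x| = 1`, and `C^k` on the closed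
region into `ContDiffOn` on the closed cone.

On the cone, `∫ ∂ₑg` equals the flux of `g e` through the lateral boundary, for `g` of class `C¹` up
to that boundary with compact support away from `0` (`setIntegral_fderiv_cone`). A partition of
unity localizes this. Near a boundary point `r₀γ(s₀)` with `e · ν > 0`, the map `((s, r), t) ↦ rγ(s)
+ te` is a `C¹` chart which straightens the boundary to `t = 0`. The curves are only `C¹`, so `ν` is
merely continuous; a fixed direction `e` keeps the chart `C¹` and makes `∂ₑ` the derivative in `t`.
The Jacobian is `r (e · ν)`, free of `t`, so the fundamental theorem of calculus in `t` gives the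
flux. An arbitrary `e` is a difference of two such directions.

Applied to `χ(|x|²) v(x/|x|)` with a bump `χ` around `1`, this becomes a statement on the sphere
(`integral_surfDiv`). In polar coordinates the divergence is `2|x| χ' ξ · v + |x|⁻¹ χ ∇* · v`;
integrating the first term by parts in `r` produces `2 ∫ η · v`, and the common radial mass `∫ r
χ(r²) dr` cancels.

The rest is algebra: `L* · v = ∇* · (v ∧ ξ)` and `ν · (v ∧ η) = τ · v` give the curl theorem
(`surfDiv_cross`), the product rule gives (b), and `∇* · ∇*H = Δ*H` (`surfDiv_surfGrad`) with `f =
∇*H` gives (c). -/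

namespace Spherical

/-! ### Radial projection, cones and radial extensions -/

theorem coe_ne_zero (ξ : S2) : (ξ : E3) ≠ 0 := ne_zero_of_mem_unit_sphere ξ

theorem norm_coe (ξ : S2) : ‖(ξ : E3)‖ = 1 := norm_eq_of_mem_sphere ξ

theorem coe_radialProj {x : E3} (hx : x ≠ 0) : (radialProj x : E3) = ‖x‖⁻¹ • x := by
  simp [radialProj, hx]

theorem radialProj_smul_coe {r : ℝ} (hr : 0 < r) (ξ : S2) : radialProj (r • (ξ : E3)) = ξ := by
  apply Subtype.ext
  rw [coe_radialProj (smul_ne_zero hr.ne' (coe_ne_zero ξ)), norm_smul, norm_coe, smul_smul,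
    Real.norm_of_nonneg hr.le, mul_one, inv_mul_cancel₀ hr.ne', one_smul]

theorem radialProj_coe (ξ : S2) : radialProj (ξ : E3) = ξ := by
  simpa using radialProj_smul_coe one_pos ξ

theorem norm_smul_radialProj {x : E3} (hx : x ≠ 0) : ‖x‖ • (radialProj x : E3) = x := by
  rw [coe_radialProj hx, smul_smul, mul_inv_cancel₀ (norm_ne_zero_iff.2 hx), one_smul]

theorem radialProj_smul {r : ℝ} (hr : 0 < r) {x : E3} (hx : x ≠ 0) :
    radialProj (r • x) = radialProj x := by
  conv_lhs => rw [← norm_smul_radialProj hx, smul_smul]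
  exact radialProj_smul_coe (mul_pos hr (norm_pos_iff.2 hx)) _

theorem radialExt_smul {r : ℝ} (hr : 0 < r) {x : E3} (hx : x ≠ 0) (F : S2 → ℝ) :
    radialExt F (r • x) = radialExt F x := by
  rw [radialExt, radialExt, radialProj_smul hr hx]

theorem radialExt_coe (F : S2 → ℝ) (ξ : S2) : radialExt F (ξ : E3) = F ξ := by
  rw [radialExt, radialProj_coe]

theorem radialExt_smul_coe (F : S2 → ℝ) {r : ℝ} (hr : 0 < r) (ξ : S2) :
    radialExt F (r • (ξ : E3)) = F ξ := by
  rw [radialExt, radialProj_smul_coe hr]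

theorem continuousOn_radialProj : ContinuousOn radialProj {0}ᶜ := by
  rw [Topology.IsInducing.subtypeVal.continuousOn_iff]
  have : ContinuousOn (fun x : E3 => ‖x‖⁻¹ • x) {0}ᶜ :=
    (continuous_norm.continuousOn.inv₀ fun x hx => norm_ne_zero_iff.2 hx).smul continuousOn_id
  exact this.congr fun x hx => coe_radialProj hx

theorem cone_eq (A : Set S2) : cone A = {0}ᶜ ∩ radialProj ⁻¹' A := rfl

theorem isOpen_cone {A : Set S2} (hA : IsOpen A) : IsOpen (cone A) :=
  continuousOn_radialProj.isOpen_inter_preimage isOpen_compl_singleton hA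

/-- A nonempty cone has the missing apex `0` in its closure; away from the apex, closedness is
inherited from `A`. -/
theorem isClosed_inter_cone {A : Set S2} (hA : IsClosed A) {K : Set E3} (hK : IsClosed K)
    (h0 : (0 : E3) ∉ K) : IsClosed (K ∩ cone A) := by
  have hsub : K ⊆ {0}ᶜ := fun x hx h => h0 (h ▸ hx)
  have := (continuousOn_radialProj.mono hsub).preimage_isClosed_of_isClosed hK hA
  convert this using 1
  ext x
  simp only [cone_eq, mem_inter_iff]
  exact ⟨fun h => ⟨h.1, h.2.2⟩, fun h => ⟨h.1, hsub h.1, h.2⟩⟩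

theorem isCompact_inter_cone {A : Set S2} (hA : IsClosed A) {K : Set E3} (hK : IsCompact K)
    (h0 : (0 : E3) ∉ K) : IsCompact (K ∩ cone A) :=
  hK.of_isClosed_subset (isClosed_inter_cone hA hK.isClosed h0) inter_subset_left

theorem cone_mono {A B : Set S2} (h : A ⊆ B) : cone A ⊆ cone B := fun _ hx => ⟨hx.1, h hx.2⟩

theorem smul_coe_mem_cone_iff {A : Set S2} {r : ℝ} (hr : 0 < r) {ξ : S2} :
    r • (ξ : E3) ∈ cone A ↔ ξ ∈ A := by
  simp [cone, hr.ne', coe_ne_zero, radialProj_smul_coe hr]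

theorem coe_mem_cone_iff {A : Set S2} {ξ : S2} : (ξ : E3) ∈ cone A ↔ ξ ∈ A := by
  simp [cone, coe_ne_zero, radialProj_coe]

theorem contMDiffOn_radialProj : ContMDiffOn 𝓘(ℝ, E3) (𝓡 2) ∞ radialProj {0}ᶜ := by
  have : Fact (Module.finrank ℝ E3 = 2 + 1) := ⟨by simp⟩
  -- Restricting the codomain to the sphere asks for a globally smooth map, so the punctured space
  -- is taken as a manifold.
  let O : TopologicalSpace.Opens E3 := ⟨{0}ᶜ, isOpen_compl_singleton⟩
  have hne : ∀ x : O, (x : E3) ≠ 0 := fun x => x.2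
  have hf : ContMDiff 𝓘(ℝ, E3) 𝓘(ℝ, E3) ∞ (fun x : O => ‖(x : E3)‖⁻¹ • (x : E3)) := fun x => by
    have : ContMDiffAt 𝓘(ℝ, E3) 𝓘(ℝ, E3) ∞ (fun x : E3 => ‖x‖⁻¹ • x) x :=
      (((contDiffAt_norm ℝ (hne x)).inv (norm_ne_zero_iff.2 (hne x))).smul
        contDiffAt_id).contMDiffAt
    exact contMDiffAt_subtype_iff.2 this
  have hs : ∀ x : O, ‖(x : E3)‖⁻¹ • (x : E3) ∈ Metric.sphere (0 : E3) 1 := fun x => by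
    simp [norm_smul, hne x]
  have h := hf.codRestrict_sphere (n := 2) hs
  intro x hx
  have h1 : ContMDiffAt 𝓘(ℝ, E3) (𝓡 2) ∞ (fun y : O => radialProj y) ⟨x, hx⟩ := by
    have he : (fun y : O => radialProj y) = codRestrict _ _ hs := by
      funext y
      exact Subtype.ext (coe_radialProj (hne y))
    rw [he]
    exact h _
  exact (contMDiffAt_subtype_iff.1 h1).contMDiffWithinAt

/-- The passage from the manifold to Euclidean calculus: the arguments below use only smoothness of
radial extensions. -/
theorem IsCk.contDiffOn_radialExt {k : ℕ} {A : Set S2} {F : S2 → ℝ} (hF : IsCk k A F) :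
    ContDiffOn ℝ k (radialExt F) (cone A) := by
  rw [← contMDiffOn_iff_contDiffOn]
  have h1 : ContMDiffOn 𝓘(ℝ, E3) (𝓡 2) k radialProj (cone A) :=
    (contMDiffOn_radialProj.mono fun x hx => hx.1).of_le (by exact_mod_cast le_top)
  exact ContMDiffOn.comp hF h1 fun x hx => hx.2

theorem IsVecCk.contDiffOn_radialExt {k : ℕ} {A : Set S2} {f : S2 → E3} (hf : IsVecCk k A f)
    (j : Fin 3) : ContDiffOn ℝ k (radialExt fun η => f η j) (cone A) := by
  refine IsCk.contDiffOn_radialExt ?_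
  have h : ContMDiff 𝓘(ℝ, E3) 𝓘(ℝ, ℝ) k (fun x : E3 => x j) :=
    (EuclideanSpace.proj (𝕜 := ℝ) j : E3 →L[ℝ] ℝ).contDiff.contMDiff
  exact h.comp_contMDiffOn hf

/-- The exterior unit normal `ν = γ' ∧ γ` along a boundary curve, as a function of arc length. -/
noncomputable def RegularRegion.nu (R : RegularRegion) (i : Fin R.n) (s : ℝ) : E3 :=
  cross (deriv (fun t => (R.γ i t : E3)) s) (R.γ i s : E3)

theorem cross_apply (a b : E3) : cross a b =
    !₂[a 1 * b 2 - a 2 * b 1, a 2 * b 0 - a 0 * b 2, a 0 * b 1 - a 1 * b 0] := by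
  simp [cross, _root_.cross_apply]

theorem inner_eq (a b : E3) : inner ℝ a b = a 0 * b 0 + a 1 * b 1 + a 2 * b 2 := by
  simp [PiLp.inner_apply, Fin.sum_univ_three, mul_comm]

theorem continuous_cross : Continuous fun p : E3 × E3 => cross p.1 p.2 := by
  simp only [cross_apply]
  refine (PiLp.continuous_toLp 2 _).comp ?_
  refine continuous_pi fun j => ?_
  fin_cases j <;> simp <;> fun_prop

/-! ### The boundary curves and their exterior normal -/

namespace RegularRegion
variable (R : RegularRegion)

theorem normal_apply (i : Fin R.n) (s : ℝ) : R.normal (R.γ i s) = R.nu i s := by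
  rw [normal, tangent_apply, nu]

theorem continuous_γ_coe (i : Fin R.n) : Continuous fun s => (R.γ i s : E3) :=
  (R.contDiff i).continuous

theorem continuous_γ (i : Fin R.n) : Continuous (R.γ i) :=
  continuous_induced_rng.2 (R.continuous_γ_coe i)

theorem hasDerivAt_γ (i : Fin R.n) (s : ℝ) : HasDerivAt (fun t => (R.γ i t : E3))
    (deriv (fun t => (R.γ i t : E3)) s) s :=
  ((R.contDiff i).differentiable one_ne_zero s).hasDerivAt

theorem continuous_deriv_γ (i : Fin R.n) : Continuous (deriv fun t => (R.γ i t : E3)) :=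
  (R.contDiff i).continuous_deriv le_rfl

theorem continuous_nu (i : Fin R.n) : Continuous (R.nu i) :=
  continuous_cross.comp ((R.continuous_deriv_γ i).prodMk (R.continuous_γ_coe i))

theorem periodic_deriv (i : Fin R.n) :
    Function.Periodic (deriv fun t => (R.γ i t : E3)) (R.len i) := fun t => by
  rw [← deriv_comp_add_const]
  congr 1
  funext x
  simp only [R.periodic i x]

theorem periodic_nu (i : Fin R.n) : Function.Periodic (R.nu i) (R.len i) := fun t => by
  simp only [nu, R.periodic_deriv i t, R.periodic i t]

theorem inner_γ_deriv (i : Fin R.n) (s : ℝ) :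
    inner ℝ (R.γ i s : E3) (deriv (fun t => (R.γ i t : E3)) s) = 0 := by
  have h := (R.hasDerivAt_γ i s).inner ℝ (R.hasDerivAt_γ i s)
  have hc : (fun t => inner ℝ (R.γ i t : E3) (R.γ i t : E3)) = fun _ => (1 : ℝ) := by
    funext t
    rw [real_inner_self_eq_norm_sq, norm_coe, one_pow]
  rw [hc] at h
  have := h.unique (hasDerivAt_const s 1)
  rw [real_inner_comm (R.γ i s : E3)] at this
  linarith

theorem inner_nu_self (i : Fin R.n) (s : ℝ) : inner ℝ (R.nu i s) (R.nu i s) = 1 := by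
  have h1 := R.inner_γ_deriv i s
  have h2 : inner ℝ (R.γ i s : E3) (R.γ i s : E3) = 1 := by
    rw [real_inner_self_eq_norm_sq, norm_coe, one_pow]
  have h3 : inner ℝ (deriv (fun t => (R.γ i t : E3)) s) (deriv (fun t => (R.γ i t : E3)) s) = 1 := by
    rw [real_inner_self_eq_norm_sq, R.unit_speed, one_pow]
  rw [nu]
  generalize deriv (fun t => (R.γ i t : E3)) s = a at *
  generalize (R.γ i s : E3) = b at *
  simp only [inner_eq, Spherical.cross_apply] at *
  simp
  -- Lagrange's identity `|a ∧ b|² = |a|²|b|² - (a · b)²`.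
  linear_combination (a 0 * a 0 + a 1 * a 1 + a 2 * a 2) * h2 + h3 -
    (b 0 * a 0 + b 1 * a 1 + b 2 * a 2) * h1

theorem γ_mem_frontier (i : Fin R.n) (s : ℝ) : R.γ i s ∈ frontier R.Γ := by
  rw [R.frontier_eq]
  exact mem_iUnion.2 ⟨i, s, rfl⟩

theorem γ_mem_closure (i : Fin R.n) (s : ℝ) : R.γ i s ∈ closure R.Γ :=
  frontier_subset_closure (R.γ_mem_frontier i s)

theorem γ_notMem (i : Fin R.n) (s : ℝ) : R.γ i s ∉ R.Γ := fun h => by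
  have := R.γ_mem_frontier i s
  rw [R.isOpen.frontier_eq] at this
  exact this.2 h

theorem cone_subset_cone_closure : cone R.Γ ⊆ cone (closure R.Γ) := cone_mono subset_closure

theorem isOpen_cone : IsOpen (cone R.Γ) := Spherical.isOpen_cone R.isOpen

theorem cone_closure_mem_nhds {x : E3} (hx : x ∈ cone R.Γ) : cone (closure R.Γ) ∈ 𝓝 x :=
  mem_of_superset (R.isOpen_cone.mem_nhds hx) R.cone_subset_cone_closure

end RegularRegion

/-! ### Frames and change of variables -/

/-- The linear map of `ℝ³`, written as `(ℝ × ℝ) × ℝ`, with the columns `a`, `b`, `c`. -/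
noncomputable def frame (a b c : E3) : (ℝ × ℝ) × ℝ →L[ℝ] E3 :=
  ((ContinuousLinearMap.fst ℝ ℝ ℝ).comp (ContinuousLinearMap.fst ℝ (ℝ × ℝ) ℝ)).smulRight a +
  ((ContinuousLinearMap.snd ℝ ℝ ℝ).comp (ContinuousLinearMap.fst ℝ (ℝ × ℝ) ℝ)).smulRight b +
  (ContinuousLinearMap.snd ℝ (ℝ × ℝ) ℝ).smulRight c

@[simp] theorem frame_apply (a b c : E3) (q : (ℝ × ℝ) × ℝ) :
    frame a b c q = q.1.1 • a + q.1.2 • b + q.2 • c := rfl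

/-- Cartesian coordinates, as a linear equivalence. -/
noncomputable def coordEquiv : ((ℝ × ℝ) × ℝ) ≃L[ℝ] E3 :=
  LinearEquiv.toContinuousLinearEquiv
    { toFun := fun q => !₂[q.1.1, q.1.2, q.2]
      invFun := fun x => ((x 0, x 1), x 2)
      map_add' := fun p q => by ext j; fin_cases j <;> simp
      map_smul' := fun r q => by ext j; fin_cases j <;> simp
      left_inv := fun q => by simp
      right_inv := fun x => by ext j; fin_cases j <;> simp }

theorem coordEquiv_apply (q : (ℝ × ℝ) × ℝ) : coordEquiv q = !₂[q.1.1, q.1.2, q.2] := rfl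

theorem coordEquiv_symm_apply (x : E3) : coordEquiv.symm x = ((x 0, x 1), x 2) := rfl

theorem measurePreserving_coordEquiv : MeasurePreserving coordEquiv := by
  have h1 := (EuclideanSpace.volume_preserving_symm_measurableEquiv_toLp (Fin 3))
  have h2 := (volume_preserving_piFinSuccAbove (fun _ : Fin 3 => ℝ) 2)
  have h3 := (volume_preserving_finTwoArrow ℝ)
  have h4 : MeasurePreserving (fun x : E3 => coordEquiv.symm x) := by
    have h5 := ((h3.prod (MeasurePreserving.id (volume : Measure ℝ))).comp
      (Measure.measurePreserving_swap (μ := (volume : Measure ℝ))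
        (ν := (volume : Measure (Fin 2 → ℝ))))).comp (h2.comp h1)
    have he : (fun x : E3 => coordEquiv.symm x) =
        (Prod.map MeasurableEquiv.finTwoArrow id ∘ Prod.swap) ∘
        (MeasurableEquiv.piFinSuccAbove (fun _ : Fin 3 => ℝ) 2) ∘
        (MeasurableEquiv.toLp 2 (Fin 3 → ℝ)).symm := rfl
    rw [he]
    exact h5
  exact h4.symm coordEquiv.symm.toHomeomorph.toMeasurableEquiv

/-- Conjugation by `coordEquiv` gives an endomorphism of `E3` whose matrix has the columns `a`, `b`,
`c`. -/
theorem det_coordEquiv_symm_comp_frame (a b c : E3) :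
    ((coordEquiv.symm : E3 →L[ℝ] (ℝ × ℝ) × ℝ).comp (frame a b c)).det =
      inner ℝ c (cross a b) := by
  set f := (coordEquiv.symm : E3 →L[ℝ] (ℝ × ℝ) × ℝ).comp (frame a b c)
  have h := LinearMap.det_conj (f : (ℝ × ℝ) × ℝ →ₗ[ℝ] (ℝ × ℝ) × ℝ) coordEquiv.toLinearEquiv
  rw [ContinuousLinearMap.det, ← h,
    ← LinearMap.det_toMatrix (EuclideanSpace.basisFun (Fin 3) ℝ).toBasis, Matrix.det_fin_three]
  simp [LinearMap.toMatrix_apply, f, coordEquiv_symm_apply, coordEquiv_apply, inner_eq, cross_apply]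
  ring

theorem frame_isInvertible {a b c : E3} (h : inner ℝ c (cross a b) ≠ 0) :
    ∃ A : ((ℝ × ℝ) × ℝ) ≃L[ℝ] E3, (A : (ℝ × ℝ) × ℝ →L[ℝ] E3) = frame a b c := by
  rw [← det_coordEquiv_symm_comp_frame] at h
  refine ⟨(ContinuousLinearMap.toContinuousLinearEquivOfDetNeZero _ h).trans coordEquiv, ?_⟩
  refine ContinuousLinearMap.ext fun q => ?_
  simp

/-- Change of variables for a map from `(ℝ × ℝ) × ℝ` to `E3`, with the Jacobian written as a
triple product. -/
theorem setIntegral_image_eq {Ψ : (ℝ × ℝ) × ℝ → E3} {a b c : (ℝ × ℝ) × ℝ → E3}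
    {s : Set ((ℝ × ℝ) × ℝ)} (hs : MeasurableSet s)
    (hΨ : ∀ q ∈ s, HasFDerivAt Ψ (frame (a q) (b q) (c q)) q) (hinj : InjOn Ψ s) (g : E3 → ℝ) :
    ∫ x in Ψ '' s, g x = ∫ q in s, |inner ℝ (c q) (cross (a q) (b q))| * g (Ψ q) := by
  have : (volume : Measure (ℝ × ℝ)).IsAddHaarMeasure :=
    inferInstanceAs ((volume : Measure ℝ).prod (volume : Measure ℝ)).IsAddHaarMeasure
  have : (volume : Measure ((ℝ × ℝ) × ℝ)).IsAddHaarMeasure :=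
    inferInstanceAs ((volume : Measure (ℝ × ℝ)).prod (volume : Measure ℝ)).IsAddHaarMeasure
  have h1 := integral_image_eq_integral_abs_det_fderiv_smul volume
    (f := fun q => coordEquiv.symm (Ψ q)) hs
    (fun q hq => (coordEquiv.symm.hasFDerivAt.comp q (hΨ q hq)).hasFDerivWithinAt)
    (fun x hx y hy h => hinj hx hy (coordEquiv.symm.injective h)) (fun q => g (coordEquiv q))
  have h2 := measurePreserving_coordEquiv.setIntegral_image_emb
    coordEquiv.toHomeomorph.measurableEmbedding g ((fun q => coordEquiv.symm (Ψ q)) '' s)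
  rw [image_image] at h2
  simp only [ContinuousLinearEquiv.apply_symm_apply] at h1 h2
  rw [h2, h1]
  simp only [det_coordEquiv_symm_comp_frame, smul_eq_mul]

/-! ### Charts of the cone along its boundary -/

namespace RegularRegion
variable (R : RegularRegion)

/-- The map `((s, r), t) ↦ r γ(s) + t e`. For fixed `e` transversal to the boundary it is a chart
of space near the boundary of the cone over the region, in which that boundary is `t = 0`. -/
noncomputable def chart (i : Fin R.n) (e : E3) (q : (ℝ × ℝ) × ℝ) : E3 :=
  q.1.2 • (R.γ i q.1.1 : E3) + q.2 • e

theorem contDiff_chart (i : Fin R.n) (e : E3) : ContDiff ℝ 1 (R.chart i e) := by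
  have h : ContDiff ℝ 1 fun q : (ℝ × ℝ) × ℝ => (R.γ i q.1.1 : E3) :=
    (R.contDiff i).comp (contDiff_fst.comp contDiff_fst)
  unfold chart
  fun_prop

theorem hasFDerivAt_chart (i : Fin R.n) (e : E3) (q : (ℝ × ℝ) × ℝ) :
    HasFDerivAt (R.chart i e)
      (frame (q.1.2 • deriv (fun t => (R.γ i t : E3)) q.1.1) (R.γ i q.1.1 : E3) e) q := by
  have h1 : HasFDerivAt (fun q : (ℝ × ℝ) × ℝ => q.1.1)
    ((ContinuousLinearMap.fst ℝ ℝ ℝ).comp (ContinuousLinearMap.fst ℝ (ℝ × ℝ) ℝ)) q :=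
    hasFDerivAt_fst.comp q hasFDerivAt_fst
  have h2 : HasFDerivAt (fun q : (ℝ × ℝ) × ℝ => q.1.2)
    ((ContinuousLinearMap.snd ℝ ℝ ℝ).comp (ContinuousLinearMap.fst ℝ (ℝ × ℝ) ℝ)) q :=
    hasFDerivAt_snd.comp q hasFDerivAt_fst
  have h3 : HasFDerivAt (fun q : (ℝ × ℝ) × ℝ => q.2) (ContinuousLinearMap.snd ℝ (ℝ × ℝ) ℝ) q :=
    hasFDerivAt_snd
  have h4 := (R.hasDerivAt_γ i q.1.1).hasFDerivAt.comp q h1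
  refine ((h2.smul h4).add (h3.smul_const e)).congr_fderiv (ContinuousLinearMap.ext fun v => ?_)
  simp [smul_smul, mul_comm]

theorem cross_smul_deriv (i : Fin R.n) (r s : ℝ) :
    cross (r • deriv (fun t => (R.γ i t : E3)) s) (R.γ i s : E3) = r • R.nu i s := by
  rw [nu]
  ext j
  fin_cases j <;> simp [cross_apply] <;> ring

theorem hasStrictFDerivAt_chart (i : Fin R.n) (e : E3) (q : (ℝ × ℝ) × ℝ) :
    HasStrictFDerivAt (R.chart i e)
      (frame (q.1.2 • deriv (fun t => (R.γ i t : E3)) q.1.1) (R.γ i q.1.1 : E3) e) q :=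
  (R.contDiff_chart i e).contDiffAt.hasStrictFDerivAt' (R.hasFDerivAt_chart i e q) one_ne_zero

theorem injOn_Ico (i : Fin R.n) (a : ℝ) : InjOn (R.γ i) (Ico a (a + R.len i)) := by
  intro x hx y hy h
  have hL := R.len_pos i
  have h1 : toIcoMod hL 0 x = toIcoMod hL 0 y := by
    refine R.injOn i (toIcoMod_mem_Ico' hL x) (toIcoMod_mem_Ico' hL y) ?_
    simp only [toIcoMod, (R.periodic i).sub_zsmul_eq, h]
  have h2 := (toIcoMod_eq_self hL).2 hx
  have h3 := (toIcoMod_eq_self hL).2 hy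
  rw [toIcoMod_inj, ← toIcoMod_inj (hp := hL) (c := a)] at h1
  rw [← h2, ← h3, h1]

theorem exists_near_param (i : Fin R.n) (s₀ s : ℝ) :
    ∃ s', |s' - s₀| ≤ R.len i / 2 ∧ R.γ i s' = R.γ i s := by
  have hL := R.len_pos i
  refine ⟨toIcoMod hL (s₀ - R.len i / 2) s, ?_, ?_⟩
  · have := toIcoMod_mem_Ico hL (s₀ - R.len i / 2) s
    rw [abs_le]
    constructor <;> linarith [this.1, this.2]
  · simp only [toIcoMod, (R.periodic i).sub_zsmul_eq]

/-- The other curves, together with the arc of `γ i` at parameter distance at least `δ` from `s₀`,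
form a closed set that misses `γ i s₀`. The cone over its complement, cut to radii near `r₀`, serves
as `N`. The condition `|s - s₀| ≤ len / 2` selects a representative modulo the period. -/
theorem exists_nhds_isolating (i : Fin R.n) (s₀ : ℝ) {r₀ δ : ℝ} (hr₀ : 0 < r₀) (hδ : 0 < δ)
    (hδL : δ ≤ R.len i / 2) : ∃ N ∈ 𝓝 (r₀ • (R.γ i s₀ : E3)), (∀ x ∈ N, x ≠ 0) ∧
      ∀ j s r, 0 < r → r • (R.γ j s : E3) ∈ N →
        j = i ∧ (|s - s₀| ≤ R.len j / 2 → |s - s₀| < δ) ∧ |r - r₀| < δ := by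
  let K : Set S2 := (⋃ j, ⋃ (_ : j ≠ i), range (R.γ j)) ∪
    R.γ i '' Icc (s₀ + δ) (s₀ + R.len i - δ)
  have hK : IsClosed K := by
    refine IsClosed.union (isClosed_iUnion_of_finite fun j => isClosed_iUnion_of_finite fun _ => ?_)
      (isCompact_Icc.image (R.continuous_γ i)).isClosed
    rw [← (R.periodic j).image_Icc (R.len_pos j) 0]
    exact (isCompact_Icc.image (R.continuous_γ j)).isClosed
  have hnK : R.γ i s₀ ∉ K := by
    rintro (h | ⟨s, hs, h⟩)
    · simp only [mem_iUnion] at h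
      obtain ⟨j, hj, h⟩ := h
      exact Set.disjoint_left.1 (R.disjoint j i hj) h ⟨s₀, rfl⟩
    · have := R.injOn_Ico i s₀ ⟨by linarith [hs.1], by linarith [hs.2]⟩
        ⟨le_rfl, by linarith [R.len_pos i]⟩ h
      linarith [hs.1]
  refine ⟨cone Kᶜ ∩ {x | |‖x‖ - r₀| < δ}, ?_, fun x hx => hx.1.1, ?_⟩
  · refine inter_mem ((Spherical.isOpen_cone hK.isOpen_compl).mem_nhds
      ((smul_coe_mem_cone_iff hr₀).2 hnK)) ?_
    refine (isOpen_lt (by fun_prop) continuous_const).mem_nhds ?_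
    simpa [norm_smul, norm_coe, abs_of_pos hr₀] using hδ
  · rintro j s r hr ⟨h1, h2⟩
    rw [smul_coe_mem_cone_iff hr] at h1
    have hj : j = i := by
      by_contra hj
      exact h1 (Or.inl (mem_iUnion₂.2 ⟨j, hj, s, rfl⟩))
    subst hj
    refine ⟨rfl, fun hs => ?_, by simpa [norm_smul, norm_coe, abs_of_pos hr] using h2⟩
    by_contra hcon
    apply h1
    right
    rw [abs_le] at hs
    -- A parameter at distance at least `δ` to the left of `s₀` enters the removed arc after one
    -- period; one to the right is already in it.
    rw [abs_lt, not_and_or] at hcon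
    rcases hcon with h | h
    · exact ⟨s + R.len j, ⟨by linarith, by linarith⟩, R.periodic j s⟩
    · exact ⟨s, ⟨by linarith, by linarith⟩, rfl⟩

end RegularRegion

theorem eventually_pos_of_hasDerivAt {h : ℝ → ℝ} {h' : ℝ} (hd : HasDerivAt h h' 0) (h0 : h 0 = 0)
    (hpos : 0 < h') : ∀ᶠ t in 𝓝[>] 0, 0 < h t := by
  have h1 := (hasDerivAt_iff_tendsto_slope.1 hd).mono_left
    (nhdsWithin_mono _ fun t (ht : (0 : ℝ) < t) => ht.ne')
  filter_upwards [h1.eventually_const_lt hpos, self_mem_nhdsWithin] with t ht htp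
  rw [slope_def_field, h0, sub_zero, sub_zero] at ht
  exact (div_pos_iff_of_pos_right htp).1 ht

/-- Otherwise the interior of `t` and the complement of its closure would separate `s`. -/
theorem _root_.IsPreconnected.inter_frontier_nonempty {X : Type*} [TopologicalSpace X]
    {s t : Set X} (hs : IsPreconnected s) (h₁ : (s ∩ t).Nonempty) (h₂ : (s ∩ tᶜ).Nonempty) :
    (s ∩ frontier t).Nonempty := by
  by_contra hcon
  have hd : ∀ x ∈ s, x ∉ frontier t := fun x hx hf => hcon ⟨x, hx, hf⟩
  obtain ⟨x, hxs, hxt⟩ := h₁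
  obtain ⟨y, hys, hyt⟩ := h₂
  obtain ⟨z, -, hz1, hz2⟩ := hs (interior t) (closure t)ᶜ isOpen_interior
    isClosed_closure.isOpen_compl
    (fun z hz => by
      by_cases h : z ∈ closure t
      · exact Or.inl (by_contra fun h' => hd z hz ⟨h, h'⟩)
      · exact Or.inr h)
    ⟨x, hxs, by_contra fun h' => hd x hxs ⟨subset_closure hxt, h'⟩⟩
    ⟨y, hys, fun h => hd y hys ⟨h, fun h' => hyt (interior_subset h')⟩⟩
  exact hz2 (subset_closure (interior_subset hz1))

/-- `ν` is orthogonal to `γ'` and `γ`, so pairing with it isolates the coordinate `t`. -/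
theorem inner_nu_frame (R : RegularRegion) (i : Fin R.n) (r s : ℝ) (e : E3) (v : (ℝ × ℝ) × ℝ) :
    inner ℝ (R.nu i s) (frame (r • deriv (fun t => (R.γ i t : E3)) s) (R.γ i s : E3) e v) =
      v.2 * inner ℝ e (R.nu i s) := by
  rw [RegularRegion.nu]
  generalize deriv (fun t => (R.γ i t : E3)) s = a at *
  generalize (R.γ i s : E3) = b at *
  simp only [inner_eq, cross_apply, frame_apply]
  simp
  ring

namespace RegularRegion
variable (R : RegularRegion)

/-- Where a curve `x` that leaves the boundary point `r₀ γ(s₀)` in the direction `w` lies with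
respect to the last coordinate of the inverse of the chart. -/
theorem exists_chart_curve (i : Fin R.n) (s₀ : ℝ) {r₀ : ℝ} (hr₀ : 0 < r₀) {e : E3}
    (he : 0 < inner ℝ e (R.nu i s₀)) {c : ℝ} (hc : c ≠ 0) {x : ℝ → E3} {S : Set ((ℝ × ℝ) × ℝ)}
    (hS : S ∈ 𝓝 ((s₀, r₀), (0 : ℝ)))
    (hx : HasDerivAt x (c • R.nu i s₀) 0) (hx0 : x 0 = r₀ • (R.γ i s₀ : E3)) :
    ∀ᶠ t in 𝓝[>] 0, ∃ q ∈ S, 0 < c * q.2 ∧ R.chart i e q = x t := by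
  set q₀ : (ℝ × ℝ) × ℝ := ((s₀, r₀), 0) with hq₀
  have hne : inner ℝ e (cross (r₀ • deriv (fun t => (R.γ i t : E3)) s₀) (R.γ i s₀ : E3)) ≠ 0 := by
    rw [cross_smul_deriv, inner_smul_right]
    exact (mul_pos hr₀ he).ne'
  obtain ⟨A, hA⟩ := frame_isInvertible hne
  have hstrict : HasStrictFDerivAt (R.chart i e) (A : (ℝ × ℝ) × ℝ →L[ℝ] E3) q₀ := by
    rw [hA]
    exact R.hasStrictFDerivAt_chart i e q₀
  have hp : R.chart i e q₀ = x 0 := by simp [chart, hq₀, hx0]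
  let L := hstrict.localInverse (R.chart i e) A q₀
  have hL : HasFDerivAt L (A.symm : E3 →L[ℝ] (ℝ × ℝ) × ℝ) (x 0) := by
    rw [← hp]
    exact hstrict.to_localInverse.hasFDerivAt
  have hL0 : L (x 0) = q₀ := by
    rw [← hp]
    exact hstrict.localInverse_apply_image
  have hLx : HasDerivAt (fun t => L (x t)) (A.symm (c • R.nu i s₀)) 0 := hL.comp_hasDerivAt 0 hx
  -- By `inner_nu_frame` the `t`-component of `A⁻¹(cν)` times `e · ν` is `c`, so it has the sign of
  -- `c`.
  have hpos : 0 < c * (A.symm (c • R.nu i s₀)).2 := by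
    have h1 := inner_nu_frame R i r₀ s₀ e (A.symm (c • R.nu i s₀))
    rw [← hA, ContinuousLinearEquiv.coe_coe, ContinuousLinearEquiv.apply_symm_apply,
      inner_smul_right, R.inner_nu_self, mul_one] at h1
    refine pos_of_mul_pos_left ?_ he.le
    rw [mul_assoc, ← h1]
    exact mul_self_pos.2 hc
  have h1 : HasDerivAt (fun t => (L (x t)).2) (A.symm (c • R.nu i s₀)).2 0 := by
    simpa using hLx.hasFDerivAt.snd.hasDerivAt
  have h2 : HasDerivAt (fun t => c * (L (x t)).2) (c * (A.symm (c • R.nu i s₀)).2) 0 :=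
    h1.const_mul c
  have h3 := eventually_pos_of_hasDerivAt h2 (by rw [hL0]; simp [hq₀]) hpos
  have h4 : ∀ᶠ t in 𝓝 (0 : ℝ), L (x t) ∈ S := by
    refine hLx.continuousAt.eventually_mem ?_
    rw [hL0]
    exact hS
  have h5 : ∀ᶠ t in 𝓝 (0 : ℝ), R.chart i e (L (x t)) = x t := by
    have : ∀ᶠ y in 𝓝 (x 0), R.chart i e (L y) = y := by
      rw [← hp]
      exact hstrict.eventually_right_inverse
    exact hx.continuousAt.eventually this
  filter_upwards [h3, h4.filter_mono nhdsWithin_le_nhds, h5.filter_mono nhdsWithin_le_nhds]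
    with t h3 h4 h5
  exact ⟨_, h4, h3, h5⟩

/-- The inverse function theorem gives the chart, since the Jacobian `r₀ (e · ν)` is nonzero. By
isolation and injectivity, the frontier meets the box only in `t = 0`. Each open half of the box is
convex, so its image on the sphere is connected and stays on one side; one point, reached along the
curves in `inside` and `outside`, decides which. -/
theorem exists_chart (i : Fin R.n) (s₀ : ℝ) {r₀ : ℝ} (hr₀ : 0 < r₀) {e : E3}
    (he : 0 < inner ℝ e (R.nu i s₀)) : ∃ δ > 0, δ < r₀ ∧ δ ≤ R.len i / 2 ∧
      InjOn (R.chart i e) (Metric.closedBall ((s₀, r₀), (0 : ℝ)) δ) ∧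
      IsOpen (R.chart i e '' Metric.ball ((s₀, r₀), (0 : ℝ)) δ) ∧
      (∀ q ∈ Metric.closedBall ((s₀, r₀), (0 : ℝ)) δ, q.2 < 0 → R.chart i e q ∈ cone R.Γ) ∧
      (∀ q ∈ Metric.closedBall ((s₀, r₀), (0 : ℝ)) δ, 0 < q.2 →
        R.chart i e q ∉ cone (closure R.Γ)) ∧
      (∀ s, |s - s₀| ≤ δ → 0 < inner ℝ e (R.nu i s)) ∧
      (∀ j s r, 0 < r → r • (R.γ j s : E3) ∈ R.chart i e '' Metric.ball ((s₀, r₀), (0 : ℝ)) δ →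
        j = i ∧ (|s - s₀| ≤ R.len j / 2 → |s - s₀| < δ) ∧ |r - r₀| < δ) := by
  set q₀ : (ℝ × ℝ) × ℝ := ((s₀, r₀), 0) with hq₀
  have hne : inner ℝ e (cross (r₀ • deriv (fun t => (R.γ i t : E3)) s₀) (R.γ i s₀ : E3)) ≠ 0 := by
    rw [cross_smul_deriv, inner_smul_right]
    exact (mul_pos hr₀ he).ne'
  obtain ⟨A, hA⟩ := frame_isInvertible hne
  have hstrict : HasStrictFDerivAt (R.chart i e) (A : (ℝ × ℝ) × ℝ →L[ℝ] E3) q₀ := by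
    rw [hA]
    exact R.hasStrictFDerivAt_chart i e q₀
  have hcont := (R.contDiff_chart i e).continuous
  have hmem : ∀ {s r : ℝ} {η : ℝ}, |s - s₀| < η → |r - r₀| < η →
      ((s, r), (0 : ℝ)) ∈ Metric.ball q₀ η := fun hs hr => by
    rw [Metric.mem_ball, Prod.dist_eq, Prod.dist_eq, Real.dist_eq, Real.dist_eq]
    simp [hq₀, hs, hr]
  have hchart0 : ∀ s r, R.chart i e ((s, r), 0) = r • (R.γ i s : E3) := fun s r => by
    simp [chart]
  let P := hstrict.toOpenPartialHomeomorph (R.chart i e)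
  have hPs : P.source ∈ 𝓝 q₀ := P.open_source.mem_nhds hstrict.mem_toOpenPartialHomeomorph_source
  have hPcoe : (P : (ℝ × ℝ) × ℝ → E3) = R.chart i e := hstrict.toOpenPartialHomeomorph_coe
  obtain ⟨δ₁, hδ₁, hball⟩ := Metric.nhds_basis_closedBall.mem_iff.1 hPs
  have hL := R.len_pos i
  set δ₂ := min δ₁ (R.len i / 2)
  have hδ₂ : 0 < δ₂ := lt_min hδ₁ (by linarith)
  obtain ⟨N, hN, hN0, hNiso⟩ := R.exists_nhds_isolating i s₀ hr₀ hδ₂ (min_le_right _ _)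
  have hN' : R.chart i e ⁻¹' N ∈ 𝓝 q₀ := by
    refine hcont.continuousAt.preimage_mem_nhds ?_
    simpa [hchart0, hq₀] using hN
  have hpos : {q : (ℝ × ℝ) × ℝ | 0 < inner ℝ e (R.nu i q.1.1)} ∈ 𝓝 q₀ := by
    refine (isOpen_lt continuous_const ?_).mem_nhds he
    exact continuous_const.inner ((R.continuous_nu i).comp (continuous_fst.comp continuous_fst))
  obtain ⟨δ₃, hδ₃, hball₃⟩ := Metric.nhds_basis_closedBall.mem_iff.1 (inter_mem hN' hpos)
  -- `δ₂` bounds the domain of injectivity and half the period, `δ₃` keeps the box in `N` with `e ·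
  -- ν > 0`, and `r₀ / 2` keeps the radii positive.
  set δ := min (min δ₂ δ₃) (r₀ / 2)
  have hδ : 0 < δ := lt_min (lt_min hδ₂ hδ₃) (by linarith)
  have hδδ₂ : δ ≤ δ₂ := (min_le_left _ _).trans (min_le_left _ _)
  have hδδ₁ : δ ≤ δ₁ := hδδ₂.trans (min_le_left _ _)
  have hδδ₃ : δ ≤ δ₃ := (min_le_left _ _).trans (min_le_right _ _)
  have hinj : InjOn (R.chart i e) (Metric.closedBall q₀ δ₁) := by
    rw [← hPcoe]
    exact P.injOn.mono hball
  have hsub3 : Metric.closedBall q₀ δ ⊆ Metric.closedBall q₀ δ₃ :=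
    Metric.closedBall_subset_closedBall hδδ₃
  have hsub1 : Metric.closedBall q₀ δ ⊆ Metric.closedBall q₀ δ₁ :=
    Metric.closedBall_subset_closedBall hδδ₁
  -- the boundary meets the chart only in `t = 0`
  have hfront : ∀ q ∈ Metric.closedBall q₀ δ, radialProj (R.chart i e q) ∈ frontier R.Γ →
      q.2 = 0 := by
    intro q hq hfr
    have hqN : R.chart i e q ∈ N := (hball₃ (hsub3 hq)).1
    rw [R.frontier_eq] at hfr
    obtain ⟨j, s, hjs⟩ := mem_iUnion.1 hfr
    obtain ⟨s', hs', hss'⟩ := R.exists_near_param j s₀ s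
    have hx0 := hN0 _ hqN
    have hr : 0 < ‖R.chart i e q‖ := norm_pos_iff.2 hx0
    have heq : ‖R.chart i e q‖ • (R.γ j s' : E3) = R.chart i e q := by
      rw [hss', hjs, norm_smul_radialProj hx0]
    obtain ⟨rfl, h1, h2⟩ := hNiso j s' _ hr (by rwa [heq])
    -- Isolation puts `((s', ‖Ψ q‖), 0)`, with `Ψ` the chart, in the larger ball of injectivity,
    -- where it has the same image as `q`.
    have h3 := hinj (hsub1 hq) (Metric.closedBall_subset_closedBall (min_le_left _ _)
      (Metric.ball_subset_closedBall (hmem (h1 hs') h2))) (by rw [hchart0, heq])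
    rw [h3]
  -- hence each half of the chart lies on one side
  have hside : ∀ (T : Set S2) (H : Set ((ℝ × ℝ) × ℝ)), frontier T ⊆ frontier R.Γ → Convex ℝ H →
      H ⊆ Metric.closedBall q₀ δ → (∀ q ∈ H, q.2 ≠ 0) →
      (∃ q ∈ H, radialProj (R.chart i e q) ∈ T) → ∀ q ∈ H, radialProj (R.chart i e q) ∈ T := by
    rintro T H hT hHc hHs hH0 ⟨p, hp, hpT⟩ q hq
    have hpre : IsPreconnected (radialProj '' (R.chart i e '' H)) := by
      refine (hHc.isPreconnected.image _ hcont.continuousOn).image _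
        (continuousOn_radialProj.mono ?_)
      rintro _ ⟨q, hq, rfl⟩
      exact hN0 _ (hball₃ (hsub3 (hHs hq))).1
    by_contra hcon
    obtain ⟨z, ⟨_, ⟨q, hq, rfl⟩, rfl⟩, hz⟩ := hpre.inter_frontier_nonempty
      ⟨_, mem_image_of_mem _ (mem_image_of_mem _ hp), hpT⟩
      ⟨_, mem_image_of_mem _ (mem_image_of_mem _ hq), hcon⟩
    exact hH0 q hq (hfront q (hHs hq) (hT hz))
  have hconv : Convex ℝ (Metric.closedBall q₀ δ) := convex_closedBall _ _
  have hlin : IsLinearMap ℝ fun q : (ℝ × ℝ) × ℝ => q.2 := (LinearMap.snd ℝ (ℝ × ℝ) ℝ).isLinear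
  have hderiv : ∀ c : ℝ, HasDerivAt (fun t : ℝ => r₀ • ((R.γ i s₀ : E3) + (t * c) • R.nu i s₀))
      ((r₀ * c) • R.nu i s₀) 0 := fun c => by
    have := ((((hasDerivAt_id (0 : ℝ)).mul_const c).smul_const (R.nu i s₀)).const_add
      (R.γ i s₀ : E3)).const_smul r₀
    rw [one_mul, smul_smul] at this
    exact this
  -- For `c = -1` and `c = 1` these are the curves of `inside` and `outside`, scaled by `r₀`, which
  -- `radialProj` does not see.
  have hcurve : ∀ c : ℝ, c ≠ 0 → _ := fun c hc => R.exists_chart_curve i s₀ hr₀ he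
    (mul_ne_zero hr₀.ne' hc) (Metric.closedBall_mem_nhds q₀ hδ) (hderiv c) (by simp)
  have hproj : ∀ y : E3, radialProj (r₀ • y) = radialProj y := fun y => by
    by_cases hy : y = 0
    · simp [hy]
    · exact radialProj_smul hr₀ hy
  have hin : ∃ q ∈ Metric.closedBall q₀ δ ∩ {q | q.2 < 0}, radialProj (R.chart i e q) ∈ R.Γ := by
    obtain ⟨t, ⟨q, hq, hqs, hqx⟩, ht⟩ :=
      ((hcurve (-1) (by norm_num)).and (R.inside i s₀)).exists
    refine ⟨q, ⟨hq, ?_⟩, ?_⟩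
    · have : 0 < r₀ * (-q.2) := by linarith
      simpa using (pos_iff_pos_of_mul_pos this).1 hr₀
    · rw [hqx, hproj]
      simpa [sub_eq_add_neg, nu] using ht
  have hout : ∃ q ∈ Metric.closedBall q₀ δ ∩ {q | 0 < q.2},
      radialProj (R.chart i e q) ∈ (closure R.Γ)ᶜ := by
    obtain ⟨t, ⟨q, hq, hqs, hqx⟩, ht⟩ :=
      ((hcurve 1 one_ne_zero).and (R.outside i s₀)).exists
    refine ⟨q, ⟨hq, ?_⟩, ?_⟩
    · rw [mul_one] at hqs
      exact (pos_iff_pos_of_mul_pos hqs).1 hr₀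
    · rw [hqx, hproj]
      simpa [nu] using ht
  refine ⟨δ, hδ, (min_le_right _ _).trans_lt (by linarith), hδδ₂.trans (min_le_right _ _),
    hinj.mono hsub1, ?_, ?_, ?_, ?_, ?_⟩
  · rw [← hPcoe]
    exact P.isOpen_image_of_subset_source Metric.isOpen_ball
      (Metric.ball_subset_closedBall.trans (hsub1.trans hball))
  · intro q hq hq2
    refine ⟨hN0 _ (hball₃ (hsub3 hq)).1, ?_⟩
    exact hside R.Γ _ subset_rfl (hconv.inter (convex_halfSpace_lt hlin 0)) inter_subset_left
      (fun q hq => (hq.2 : q.2 < 0).ne) hin q ⟨hq, hq2⟩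
  · intro q hq hq2 hcon
    refine hside (closure R.Γ)ᶜ _ ?_ (hconv.inter (convex_halfSpace_gt hlin 0)) inter_subset_left
      (fun q hq => (hq.2 : 0 < q.2).ne') hout q ⟨hq, hq2⟩ hcon.2
    rw [frontier_compl]
    exact frontier_closure_subset
  · intro s hs
    have : ((s, r₀), (0 : ℝ)) ∈ Metric.closedBall q₀ δ := by
      rw [Metric.mem_closedBall, Prod.dist_eq, Prod.dist_eq, Real.dist_eq]
      simpa [hq₀, hδ.le] using hs
    exact (hball₃ (hsub3 this)).2
  · rintro j s r hr ⟨q, hq, hqe⟩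
    have hqN : r • (R.γ j s : E3) ∈ N := by
      rw [← hqe]
      exact (hball₃ (hsub3 (Metric.ball_subset_closedBall hq))).1
    obtain ⟨rfl, -, h2⟩ := hNiso j s r hr hqN
    -- Isolation alone yields only the radius `δ₂`; injectivity then identifies the point with `q`,
    -- which lies in the ball of radius `δ`.
    have key : ∀ s', |s' - s₀| ≤ R.len j / 2 → R.γ j s' = R.γ j s →
        |s' - s₀| < δ ∧ |r - r₀| < δ := by
      intro s' hs' hss'
      obtain ⟨-, h1, -⟩ := hNiso j s' r hr (hss' ▸ hqN)
      have h3 : q = ((s', r), 0) := hinj (hsub1 (Metric.ball_subset_closedBall hq))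
        (Metric.closedBall_subset_closedBall (min_le_left _ _)
        (Metric.ball_subset_closedBall (hmem (h1 hs') h2))) (by rw [hchart0, hqe, hss'])
      rw [h3, Metric.mem_ball, Prod.dist_eq, Prod.dist_eq, Real.dist_eq, Real.dist_eq] at hq
      simp only [hq₀, max_lt_iff] at hq
      exact hq.1
    obtain ⟨s', hs', hss'⟩ := R.exists_near_param j s₀ s
    exact ⟨rfl, fun hs => (key s hs rfl).1, (key s' hs' hss').2⟩

end RegularRegion

/-! ### The divergence theorem near a boundary point -/

namespace RegularRegion
variable (R : RegularRegion)

theorem chart_mem_cone_closure {i : Fin R.n} {s₀ r₀ δ : ℝ} {e : E3} (hδ : δ < r₀)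
    (hneg : ∀ q ∈ Metric.closedBall ((s₀, r₀), (0 : ℝ)) δ, q.2 < 0 → R.chart i e q ∈ cone R.Γ)
    {q : (ℝ × ℝ) × ℝ} (hq : q ∈ Metric.closedBall ((s₀, r₀), (0 : ℝ)) δ) (hq2 : q.2 ≤ 0) :
    R.chart i e q ∈ cone (closure R.Γ) := by
  rcases hq2.lt_or_eq with h | h
  · exact R.cone_subset_cone_closure (hneg q hq h)
  · have hr : 0 < q.1.2 := by
      rw [Metric.mem_closedBall, Prod.dist_eq, Prod.dist_eq, Real.dist_eq, Real.dist_eq] at hq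
      have h1 := ((le_max_right _ _).trans (le_max_left _ _)).trans hq
      have h2 := neg_abs_le (q.1.2 - r₀)
      simp only at h1
      linarith
    rw [chart, h, zero_smul, add_zero, smul_coe_mem_cone_iff hr]
    exact R.γ_mem_closure _ _

theorem mem_cone_closure_cases {x : E3} (hx : x ∈ cone (closure R.Γ)) :
    x ∈ cone R.Γ ∨ ∃ i s, ∃ r : ℝ, 0 < r ∧ x = r • (R.γ i s : E3) := by
  by_cases h : radialProj x ∈ R.Γ
  · exact Or.inl ⟨hx.1, h⟩
  · right
    have h1 : radialProj x ∈ frontier R.Γ := by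
      rw [R.isOpen.frontier_eq]
      exact ⟨hx.2, h⟩
    rw [R.frontier_eq] at h1
    obtain ⟨i, s, hs⟩ := mem_iUnion.1 h1
    exact ⟨i, s, ‖x‖, norm_pos_iff.2 hx.1, by rw [hs, norm_smul_radialProj hx.1]⟩

theorem smul_γ_notMem_cone (i : Fin R.n) {s r : ℝ} (hr : 0 < r) :
    r • (R.γ i s : E3) ∉ cone R.Γ := by
  rw [smul_coe_mem_cone_iff hr]
  exact R.γ_notMem i s

/-- Makes `fderivWithin` continuous up to the boundary. At a boundary point the closed cone contains
the chart image of a convex half box with interior, and the differential of the chart is onto. -/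
theorem uniqueDiffOn_cone_closure : UniqueDiffOn ℝ (cone (closure R.Γ)) := by
  intro x hx
  rcases R.mem_cone_closure_cases hx with h | ⟨i, s₀, r₀, hr₀, rfl⟩
  · exact uniqueDiffWithinAt_of_mem_nhds (R.cone_closure_mem_nhds h)
  · have he : 0 < inner ℝ (R.nu i s₀) (R.nu i s₀) := by
      rw [R.inner_nu_self]
      exact one_pos
    obtain ⟨δ, hδ, hδr, -, -, -, hneg, -⟩ := R.exists_chart i s₀ hr₀ he
    have hlin : IsLinearMap ℝ fun q : (ℝ × ℝ) × ℝ => q.2 := (LinearMap.snd ℝ (ℝ × ℝ) ℝ).isLinear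
    set q₀ : (ℝ × ℝ) × ℝ := ((s₀, r₀), 0) with hq₀
    have hconv := (convex_closedBall q₀ δ).inter (convex_halfSpace_le hlin 0)
    have hopen : IsOpen (Metric.ball q₀ δ ∩ {q | q.2 < 0}) :=
      Metric.isOpen_ball.inter (isOpen_lt continuous_snd continuous_const)
    have hint : (interior (Metric.closedBall q₀ δ ∩ {q | q.2 ≤ 0})).Nonempty := by
      have hsub : Metric.ball q₀ δ ∩ {q | q.2 < 0} ⊆ Metric.closedBall q₀ δ ∩ {q | q.2 ≤ 0} :=
        fun q hq => ⟨Metric.ball_subset_closedBall hq.1,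
          show q.2 ≤ 0 from le_of_lt (show q.2 < 0 from hq.2)⟩
      refine ⟨((s₀, r₀), -(δ / 2)), interior_maximal hsub hopen ⟨?_, ?_⟩⟩
      · rw [Metric.mem_ball, Prod.dist_eq, dist_self, Real.dist_eq]
        simpa [hq₀] using abs_lt.2 ⟨by linarith, by linarith⟩
      · simpa using hδ
    have hu := uniqueDiffWithinAt_convex hconv hint (x := q₀)
      (subset_closure ⟨Metric.mem_closedBall_self hδ.le, le_refl (0 : ℝ)⟩)
    have hne : inner ℝ (R.nu i s₀)
        (cross (r₀ • deriv (fun t => (R.γ i t : E3)) s₀) (R.γ i s₀ : E3)) ≠ 0 := by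
      rw [cross_smul_deriv, inner_smul_right]
      exact (mul_pos hr₀ he).ne'
    obtain ⟨A, hA⟩ := frame_isInvertible hne
    have hd := (R.hasFDerivAt_chart i (R.nu i s₀) q₀).hasFDerivWithinAt
      (s := Metric.closedBall q₀ δ ∩ {q | q.2 ≤ 0})
    rw [← hA] at hd
    have h := hd.uniqueDiffWithinAt hu A.surjective.denseRange
    have hx0 : R.chart i (R.nu i s₀) q₀ = r₀ • (R.γ i s₀ : E3) := by simp [chart, hq₀]
    rw [hx0] at h
    refine h.mono ?_
    rintro _ ⟨q, ⟨hq, hq2⟩, rfl⟩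
    exact R.chart_mem_cone_closure hδr hneg hq hq2

variable {R}

theorem continuousOn_fderivWithin_apply {g : E3 → ℝ} (hg : ContDiffOn ℝ 1 g (cone (closure R.Γ)))
    (e : E3) : ContinuousOn (fun x => fderivWithin ℝ g (cone (closure R.Γ)) x e)
      (cone (closure R.Γ)) :=
  (hg.continuousOn_fderivWithin R.uniqueDiffOn_cone_closure le_rfl).clm_apply continuousOn_const

theorem fderivWithin_eq {V : Type*} [NormedAddCommGroup V] [NormedSpace ℝ V] {g : E3 → V}
    {x : E3} (hx : x ∈ cone R.Γ) :
    fderivWithin ℝ g (cone (closure R.Γ)) x = fderiv ℝ g x :=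
  fderivWithin_of_mem_nhds (R.cone_closure_mem_nhds hx)

theorem fderiv_eq_zero_of_notMem_tsupport {g : E3 → ℝ} {x : E3} (hx : x ∉ tsupport g) :
    fderiv ℝ g x = 0 :=
  image_eq_zero_of_notMem_tsupport fun h => hx (tsupport_fderiv_subset ℝ h)

/-- On the open cone `fderiv` agrees with `fderivWithin`, which is continuous on the compact part of
the closed cone in the support. -/
theorem integrableOn_fderiv_apply {g : E3 → ℝ} (hg : ContDiffOn ℝ 1 g (cone (closure R.Γ)))
    (hc : HasCompactSupport g) (h0 : (0 : E3) ∉ tsupport g) (e : E3) :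
    IntegrableOn (fun x => fderiv ℝ g x e) (cone R.Γ) := by
  have h1 := ((continuousOn_fderivWithin_apply hg e).mono inter_subset_right).integrableOn_compact
    (isCompact_inter_cone isClosed_closure hc h0) (μ := volume)
  have hm : MeasurableSet (tsupport g ∩ cone R.Γ) :=
    (isClosed_tsupport g).measurableSet.inter R.isOpen_cone.measurableSet
  have h2 := (h1.mono_set (inter_subset_inter_right _ R.cone_subset_cone_closure)).congr_fun
    (g := fun x => fderiv ℝ g x e) (fun x hx => by simp only [fderivWithin_eq hx.2]) hm
  refine h2.of_forall_sdiff_eq_zero R.isOpen_cone.measurableSet fun x hx => ?_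
  rw [fderiv_eq_zero_of_notMem_tsupport fun h => hx.2 ⟨h, hx.1⟩]
  rfl

/-- The component in the direction `e` of the flux of `g` through the boundary of the cone. -/
noncomputable def boundaryTerm (R : RegularRegion) (e : E3) (g : E3 → ℝ) : ℝ :=
  ∑ j, ∫ s in (0 : ℝ)..R.len j, ∫ r in Ioi (0 : ℝ),
    r * g (r • (R.γ j s : E3)) * inner ℝ e (R.nu j s)

/-- In the chart the derivative along `e` is `∂/∂t` and the volume element is `r (e · ν) ds dr dt`.
Integrating over `-δ < t < 0` leaves the value at `t = 0`, which is the boundary integrand. -/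
theorem exists_local_divergence_of_pos (i : Fin R.n) (s₀ : ℝ) {r₀ : ℝ} (hr₀ : 0 < r₀) {e : E3}
    (he : 0 < inner ℝ e (R.nu i s₀)) : ∃ W : Set E3, IsOpen W ∧ r₀ • (R.γ i s₀ : E3) ∈ W ∧
      ∀ g : E3 → ℝ, ContDiffOn ℝ 1 g (cone (closure R.Γ)) → tsupport g ⊆ W →
        ∫ x in cone R.Γ, fderiv ℝ g x e = R.boundaryTerm e g := by
  obtain ⟨δ, hδ, hδr, hδL, hinj, hopen, hneg, hpos, hnu, hiso⟩ := R.exists_chart i s₀ hr₀ he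
  set q₀ : (ℝ × ℝ) × ℝ := ((s₀, r₀), 0) with hq₀
  set Ψ := R.chart i e with hΨ
  have hcontΨ : Continuous Ψ := (R.contDiff_chart i e).continuous
  refine ⟨Ψ '' Metric.ball q₀ δ, hopen, ⟨q₀, Metric.mem_ball_self hδ, by simp [hΨ, chart, hq₀]⟩, ?_⟩
  intro g hg hsupp
  set C := cone (closure R.Γ)
  have hg0 : ∀ x, x ∉ Ψ '' Metric.ball q₀ δ → g x = 0 := fun x hx =>
    image_eq_zero_of_notMem_tsupport fun h => hx (hsupp h)
  have hΨ0 : ∀ s r, Ψ ((s, r), 0) = r • (R.γ i s : E3) := fun s r => by simp [hΨ, chart]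
  set B := Metric.ball (s₀, r₀) δ with hB
  have hball : Metric.ball q₀ δ = B ×ˢ Metric.ball (0 : ℝ) δ := (ball_prod_same _ _ _).symm
  have hcball : Metric.closedBall q₀ δ = Metric.closedBall (s₀, r₀) δ ×ˢ Metric.closedBall (0 : ℝ) δ :=
    (closedBall_prod_same _ _ _).symm
  have hBr : ∀ p ∈ Metric.closedBall (s₀, r₀) δ, |p.1 - s₀| ≤ δ ∧ 0 < p.2 := by
    intro p hp
    rw [Metric.mem_closedBall, Prod.dist_eq, Real.dist_eq, Real.dist_eq, max_le_iff] at hp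
    exact ⟨hp.1, by linarith [neg_abs_le (p.2 - r₀), hp.2]⟩
  set S := B ×ˢ Ioo (-δ) 0 with hS
  have hSball : S ⊆ Metric.ball q₀ δ := by
    rw [hball, Real.ball_eq_Ioo]
    exact prod_mono subset_rfl (Ioo_subset_Ioo (by simp) (by simpa using hδ.le))
  have hSm : MeasurableSet S := Metric.isOpen_ball.measurableSet.prod measurableSet_Ioo
  have hScb : S ⊆ Metric.closedBall q₀ δ := hSball.trans Metric.ball_subset_closedBall
  let D : E3 → ℝ := fun x => fderivWithin ℝ g C x e
  have hDcont : ContinuousOn D C := continuousOn_fderivWithin_apply hg e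
  -- the part of the cone in the chart is the lower half of the box
  have h1 : ∫ x in cone R.Γ, fderiv ℝ g x e = ∫ x in Ψ '' S, D x := by
    rw [setIntegral_congr_fun (g := D) R.isOpen_cone.measurableSet
      (fun x hx => by simp only [D]; rw [fderivWithin_eq hx])]
    refine setIntegral_eq_of_subset_of_forall_sdiff_eq_zero R.isOpen_cone.measurableSet ?_ ?_
    · rintro _ ⟨q, hq, rfl⟩
      exact hneg q (hScb hq) hq.2.2
    · rintro x ⟨hx, hxS⟩
      have hxn : x ∉ tsupport g := by
        intro hxt
        obtain ⟨q, hq, rfl⟩ := hsupp hxt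
        have hqc := Metric.ball_subset_closedBall hq
        rcases lt_trichotomy q.2 0 with h | h | h
        · refine hxS ⟨q, ?_, rfl⟩
          rw [hball, Real.ball_eq_Ioo] at hq
          exact ⟨hq.1, by simpa using hq.2.1, h⟩
        · rw [hcball] at hqc
          refine R.smul_γ_notMem_cone i (hBr _ hqc.1).2 (s := q.1.1) ?_
          rw [← hΨ0, ← h]
          exact hx
        · exact hpos q hqc h (R.cone_subset_cone_closure hx)
      simp only [D]
      rw [fderivWithin_eq hx, fderiv_eq_zero_of_notMem_tsupport hxn]
      rfl
  have hcov := setIntegral_image_eq hSm (fun q _ => R.hasFDerivAt_chart i e q)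
    (hinj.mono hScb) D
  have hdet : ∀ q ∈ S, |inner ℝ e (cross (q.1.2 • deriv (fun t => (R.γ i t : E3)) q.1.1)
      (R.γ i q.1.1 : E3))| * D (R.chart i e q) =
      (q.1.2 * inner ℝ e (R.nu i q.1.1)) * D (Ψ q) := by
    intro q hq
    obtain ⟨hs, hr⟩ := hBr q.1 (Metric.ball_subset_closedBall hq.1)
    rw [cross_smul_deriv, inner_smul_right, abs_of_pos (mul_pos hr (hnu _ hs))]
  rw [h1, hcov, setIntegral_congr_fun hSm hdet]
  have hT : Metric.closedBall (s₀, r₀) δ ×ˢ Icc (-δ) 0 ⊆ Metric.closedBall q₀ δ := by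
    rw [hcball, Real.closedBall_eq_Icc]
    exact prod_mono subset_rfl (Icc_subset_Icc (by simp) (by simpa using hδ.le))
  have hTC : ∀ q ∈ Metric.closedBall (s₀, r₀) δ ×ˢ Icc (-δ) 0, Ψ q ∈ C := fun q hq =>
    R.chart_mem_cone_closure hδr hneg (hT hq) hq.2.2
  have hnuc : Continuous fun p : ℝ × ℝ => inner ℝ e (R.nu i p.1) :=
    continuous_const.inner ((R.continuous_nu i).comp continuous_fst)
  have hDΨ : ContinuousOn (fun q : (ℝ × ℝ) × ℝ => D (Ψ q))
      (Metric.closedBall (s₀, r₀) δ ×ˢ Icc (-δ) 0) := hDcont.comp hcontΨ.continuousOn hTC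
  have hint : IntegrableOn (fun q : (ℝ × ℝ) × ℝ => (q.1.2 * inner ℝ e (R.nu i q.1.1)) * D (Ψ q)) S := by
    refine IntegrableOn.mono_set ?_ (prod_mono Metric.ball_subset_closedBall Ioo_subset_Icc_self)
    refine ContinuousOn.integrableOn_compact
      ((isCompact_closedBall (s₀, r₀) δ).prod isCompact_Icc) (ContinuousOn.mul ?_ hDΨ)
    exact ((continuous_snd.comp continuous_fst).mul (hnuc.comp continuous_fst)).continuousOn
  rw [hS, Measure.volume_eq_prod, setIntegral_prod _ hint]
  -- integration along the direction `e`
  have hline : ∀ p ∈ B, ∫ t in Ioo (-δ) 0, (p.2 * inner ℝ e (R.nu i p.1)) * D (Ψ (p, t)) =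
      p.2 * g (p.2 • (R.γ i p.1 : E3)) * inner ℝ e (R.nu i p.1) := by
    intro p hp
    have hpc := Metric.ball_subset_closedBall hp
    rw [integral_const_mul, ← integral_Ioc_eq_integral_Ioo,
      ← intervalIntegral.integral_of_le (by linarith)]
    have hpt : Continuous fun t : ℝ => Ψ (p, t) := hcontΨ.comp (by fun_prop)
    have hmaps : MapsTo (fun t : ℝ => Ψ (p, t)) (Icc (-δ) 0) C := fun t ht => hTC (p, t) ⟨hpc, ht⟩
    have hftc := intervalIntegral.integral_eq_sub_of_hasDerivAt_of_le (a := -δ) (b := 0)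
      (f := fun t => g (Ψ (p, t))) (f' := fun t => D (Ψ (p, t))) (by linarith)
      (hg.continuousOn.comp hpt.continuousOn hmaps) ?_ ?_
    · rw [hftc]
      -- The bottom face lies in the closed but not the open box; by injectivity its image avoids
      -- the support of `g`.
      have hlow : g (Ψ (p, -δ)) = 0 := by
        refine hg0 _ ?_
        rintro ⟨q, hq, hqe⟩
        have := hinj (Metric.ball_subset_closedBall hq) (hT ⟨hpc, by simp [hδ.le]⟩) hqe
        rw [this, hball] at hq
        have := hq.2
        simp [abs_of_pos hδ] at this
      simp only [hlow, hΨ0 p.1 p.2]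
      ring
    · intro t ht
      have hU : Ψ (p, t) ∈ cone R.Γ := hneg _ (hScb ⟨hp, ht⟩) ht.2
      have hd : HasFDerivAt g (fderivWithin ℝ g C (Ψ (p, t))) (Ψ (p, t)) :=
        ((hg.differentiableOn one_ne_zero _
          (R.cone_subset_cone_closure hU)).hasFDerivWithinAt).hasFDerivAt
          (R.cone_closure_mem_nhds hU)
      have hl : HasDerivAt (fun t : ℝ => Ψ (p, t)) e t := by
        have := ((hasDerivAt_id t).smul_const e).const_add (p.2 • (R.γ i p.1 : E3))
        rw [one_smul] at this
        exact this
      exact hd.comp_hasDerivAt t hl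
    · refine ContinuousOn.intervalIntegrable_of_Icc (by linarith) ?_
      exact hDcont.comp hpt.continuousOn hmaps
  rw [setIntegral_congr_fun Metric.isOpen_ball.measurableSet hline]
  -- localization of the boundary term
  have hW : ∀ j s r, 0 < r → ¬(j = i ∧ (|s - s₀| ≤ R.len j / 2 → |s - s₀| < δ) ∧ |r - r₀| < δ) →
      g (r • (R.γ j s : E3)) = 0 := fun j s r hr hn => hg0 _ fun h => hn (hiso j s r hr h)
  rw [boundaryTerm, Finset.sum_eq_single i]
  rotate_left
  · intro j _ hj
    have hz : ∀ s, ∫ r in Ioi (0 : ℝ), r * g (r • (R.γ j s : E3)) * inner ℝ e (R.nu j s) = 0 :=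
      fun s => setIntegral_eq_zero_of_forall_eq_zero fun r hr => by
        rw [hW j s r hr fun h => hj h.1]
        simp
    simp only [hz, intervalIntegral.integral_zero]
  · simp
  set k : ℝ → ℝ → ℝ := fun s r => r * g (r • (R.γ i s : E3)) * inner ℝ e (R.nu i s) with hk
  -- Periodicity allows a period interval centred at `s₀`, as the isolation clause of the chart
  -- requires.
  have hper : Function.Periodic (fun s => ∫ r in Ioi (0 : ℝ), k s r) (R.len i) := fun s => by
    simp only [hk, R.periodic i s, R.periodic_nu i s]
  have hshift := hper.intervalIntegral_add_eq 0 (s₀ - R.len i / 2)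
  rw [zero_add] at hshift
  change _ = ∫ s in (0 : ℝ)..R.len i, ∫ r in Ioi (0 : ℝ), k s r
  rw [hshift, intervalIntegral.integral_of_le (by linarith [R.len_pos i]),
    setIntegral_eq_of_subset_of_forall_sdiff_eq_zero (s := Metric.ball s₀ δ) measurableSet_Ioc]
  rotate_left
  · rw [Real.ball_eq_Ioo]
    exact fun s hs => ⟨by linarith [hs.1], by linarith [hs.2]⟩
  · rintro s ⟨hs, hsn⟩
    refine setIntegral_eq_zero_of_forall_eq_zero fun r hr => ?_
    simp only [hk]
    rw [hW i s r hr fun h => hsn (h.2.1 (abs_le.2 ⟨by linarith [hs.1], by linarith [hs.2]⟩))]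
    simp
  have hr : ∀ s ∈ Metric.ball s₀ δ, ∫ r in Ioi (0 : ℝ), k s r = ∫ r in Metric.ball r₀ δ, k s r := by
    intro s _
    refine setIntegral_eq_of_subset_of_forall_sdiff_eq_zero measurableSet_Ioi ?_ ?_
    · rw [Real.ball_eq_Ioo]
      exact fun r hr => by
        have := hr.1
        simp only [mem_Ioi]
        linarith
    · rintro r ⟨hr, hrn⟩
      simp only [hk]
      rw [hW i s r hr fun h => hrn h.2.2]
      simp
  rw [setIntegral_congr_fun Metric.isOpen_ball.measurableSet hr, ← ball_prod_same,
    Measure.volume_eq_prod, setIntegral_prod]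
  refine IntegrableOn.mono_set ?_ (prod_mono Metric.ball_subset_closedBall
    Metric.ball_subset_closedBall)
  rw [closedBall_prod_same]
  refine ContinuousOn.integrableOn_compact (isCompact_closedBall _ _) ?_
  refine (continuous_snd.continuousOn.mul (hg.continuousOn.comp ?_ ?_)).mul hnuc.continuousOn
  · exact (continuous_snd.smul ((R.continuous_γ_coe i).comp continuous_fst)).continuousOn
  · intro p hp
    rw [smul_coe_mem_cone_iff (hBr p hp).2]
    exact R.γ_mem_closure _ _

end RegularRegion

/-! ### The divergence theorem on the cone -/

namespace RegularRegion
variable {R : RegularRegion}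

theorem exists_norm_bounds {g : E3 → ℝ} (hc : HasCompactSupport g) (h0 : (0 : E3) ∉ tsupport g) :
    ∃ a b : ℝ, 0 < a ∧ ∀ x ∈ tsupport g, a ≤ ‖x‖ ∧ ‖x‖ ≤ b := by
  obtain ⟨b, hb⟩ := hc.isBounded.exists_norm_le
  obtain ⟨a, ha, hab⟩ := Metric.mem_nhds_iff.1 ((isClosed_tsupport g).isOpen_compl.mem_nhds h0)
  refine ⟨a, b, ha, fun x hx => ⟨?_, hb x hx⟩⟩
  by_contra hcon
  exact hab (mem_ball_zero_iff.2 (not_le.1 hcon)) hx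

/-- The integrand of the boundary term, as a function of arc length and radius, is integrable. -/
theorem integrableOn_boundary {g : E3 → ℝ} (hg : ContDiffOn ℝ 1 g (cone (closure R.Γ)))
    (hc : HasCompactSupport g) (h0 : (0 : E3) ∉ tsupport g) (e : E3) (j : Fin R.n) :
    IntegrableOn (fun p : ℝ × ℝ => p.2 * g (p.2 • (R.γ j p.1 : E3)) * inner ℝ e (R.nu j p.1))
      (Ioc 0 (R.len j) ×ˢ Ioi 0) := by
  obtain ⟨a, b, ha, hab⟩ := exists_norm_bounds hc h0
  have h1 : IntegrableOn
      (fun p : ℝ × ℝ => p.2 * g (p.2 • (R.γ j p.1 : E3)) * inner ℝ e (R.nu j p.1))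
      (Icc 0 (R.len j) ×ˢ Icc a b) := by
    refine ContinuousOn.integrableOn_compact (isCompact_Icc.prod isCompact_Icc) ?_
    refine (continuous_snd.continuousOn.mul (hg.continuousOn.comp ?_ ?_)).mul ?_
    · exact (continuous_snd.smul ((R.continuous_γ_coe j).comp continuous_fst)).continuousOn
    · intro p hp
      rw [smul_coe_mem_cone_iff (ha.trans_le hp.2.1)]
      exact R.γ_mem_closure _ _
    · exact (continuous_const.inner ((R.continuous_nu j).comp continuous_fst)).continuousOn
  refine h1.of_forall_sdiff_eq_zero (measurableSet_Ioc.prod measurableSet_Ioi) ?_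
  rintro ⟨s, r⟩ ⟨⟨hs, hr⟩, hn⟩
  have : g (r • (R.γ j s : E3)) = 0 := by
    refine image_eq_zero_of_notMem_tsupport fun h => hn ⟨Ioc_subset_Icc_self hs, ?_⟩
    have := hab _ h
    rwa [norm_smul, norm_coe, mul_one, Real.norm_of_nonneg (le_of_lt hr)] at this
  simp [this]

theorem intervalIntegrable_boundary {g : E3 → ℝ} (hg : ContDiffOn ℝ 1 g (cone (closure R.Γ)))
    (hc : HasCompactSupport g) (h0 : (0 : E3) ∉ tsupport g) (e : E3) (j : Fin R.n) :
    IntervalIntegrable (fun s => ∫ r in Ioi (0 : ℝ),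
      r * g (r • (R.γ j s : E3)) * inner ℝ e (R.nu j s)) volume 0 (R.len j) := by
  rw [intervalIntegrable_iff_integrableOn_Ioc_of_le (R.len_pos j).le]
  have h := integrableOn_boundary hg hc h0 e j
  rw [IntegrableOn, Measure.volume_eq_prod, ← Measure.prod_restrict] at h
  exact h.integral_prod_left

theorem boundaryTerm_sub_smul {g : E3 → ℝ} (hg : ContDiffOn ℝ 1 g (cone (closure R.Γ)))
    (hc : HasCompactSupport g) (h0 : (0 : E3) ∉ tsupport g) (e e' : E3) (c : ℝ) :
    R.boundaryTerm (e - c • e') g = R.boundaryTerm e g - c * R.boundaryTerm e' g := by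
  simp only [boundaryTerm, Finset.mul_sum, ← Finset.sum_sub_distrib]
  refine Finset.sum_congr rfl fun j _ => ?_
  rw [← intervalIntegral.integral_const_mul, ← intervalIntegral.integral_sub
    (intervalIntegrable_boundary hg hc h0 e j)
    ((intervalIntegrable_boundary hg hc h0 e' j).const_mul c)]
  refine intervalIntegral.integral_congr fun s _ => ?_
  simp only [integral_mul_const, inner_sub_left, inner_smul_left]
  simp
  ring

theorem boundaryTerm_eq_zero {g : E3 → ℝ} (e : E3)
    (h : ∀ j s (r : ℝ), 0 < r → g (r • (R.γ j s : E3)) = 0) : R.boundaryTerm e g = 0 := by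
  refine Finset.sum_eq_zero fun j _ => ?_
  have hz : ∀ s, ∫ r in Ioi (0 : ℝ), r * g (r • (R.γ j s : E3)) * inner ℝ e (R.nu j s) = 0 :=
    fun s => setIntegral_eq_zero_of_forall_eq_zero fun r hr => by
      rw [h j s r hr]
      simp
  simp only [hz, intervalIntegral.integral_zero]

theorem boundaryTerm_sum {ι : Type*} (T : Finset ι) {g : ι → E3 → ℝ}
    (hg : ∀ i ∈ T, ContDiffOn ℝ 1 (g i) (cone (closure R.Γ)))
    (hc : ∀ i ∈ T, HasCompactSupport (g i)) (h0 : ∀ i ∈ T, (0 : E3) ∉ tsupport (g i)) (e : E3) :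
    R.boundaryTerm e (fun x => ∑ i ∈ T, g i x) = ∑ i ∈ T, R.boundaryTerm e (g i) := by
  simp only [boundaryTerm]
  rw [Finset.sum_comm]
  refine Finset.sum_congr rfl fun j _ => ?_
  rw [← intervalIntegral.integral_finsetSum fun i hi =>
    intervalIntegrable_boundary (hg i hi) (hc i hi) (h0 i hi) e j]
  rw [intervalIntegral.integral_of_le (R.len_pos j).le,
    intervalIntegral.integral_of_le (R.len_pos j).le]
  -- By Fubini the radial integrals converge for almost every `s`, which suffices to exchange them
  -- with the sum.
  have hae : ∀ᵐ s ∂(volume.restrict (Ioc 0 (R.len j))), ∀ i ∈ T, Integrable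
      (fun r => r * g i (r • (R.γ j s : E3)) * inner ℝ e (R.nu j s))
      (volume.restrict (Ioi 0)) := by
    rw [Filter.eventually_all_finset]
    intro i hi
    have h := integrableOn_boundary (hg i hi) (hc i hi) (h0 i hi) e j
    rw [IntegrableOn, Measure.volume_eq_prod, ← Measure.prod_restrict] at h
    exact h.prod_right_ae
  refine integral_congr_ae ?_
  filter_upwards [hae] with s hs
  rw [← integral_finsetSum _ hs]
  simp only [Finset.mul_sum, Finset.sum_mul]

/-- The divergence theorem on the cone holds for functions supported near `p`. -/
def LocalDivergence (R : RegularRegion) (e p : E3) : Prop :=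
  ∃ W : Set E3, IsOpen W ∧ p ∈ W ∧ ∀ g : E3 → ℝ, ContDiffOn ℝ 1 g (cone (closure R.Γ)) →
    HasCompactSupport g → (0 : E3) ∉ tsupport g → tsupport g ⊆ W →
      ∫ x in cone R.Γ, fderiv ℝ g x e = R.boundaryTerm e g

/-- Both sides are linear in the direction, and `e = (e + Mν) - Mν` where both parts have positive
product with `ν`: indeed `(e + Mν) · ν ≥ 1` for `M = |e · ν| + 1`. -/
theorem localDivergence_boundary (i : Fin R.n) (s₀ : ℝ) {r₀ : ℝ} (hr₀ : 0 < r₀) (e : E3) :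
    R.LocalDivergence e (r₀ • (R.γ i s₀ : E3)) := by
  set ν := R.nu i s₀
  set M := |inner ℝ e ν| + 1
  have hν : 0 < inner ℝ ν ν := by
    rw [R.inner_nu_self]
    exact one_pos
  have hM : 0 < inner ℝ (e + M • ν) ν := by
    rw [inner_add_left, inner_smul_left, R.inner_nu_self]
    simp only [M, conj_trivial, mul_one]
    linarith [neg_abs_le (inner ℝ e ν)]
  obtain ⟨W₁, ho₁, hp₁, h₁⟩ := R.exists_local_divergence_of_pos i s₀ hr₀ hν
  obtain ⟨W₂, ho₂, hp₂, h₂⟩ := R.exists_local_divergence_of_pos i s₀ hr₀ hM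
  refine ⟨W₁ ∩ W₂, ho₁.inter ho₂, ⟨hp₁, hp₂⟩, fun g hg hc h0 hW => ?_⟩
  have he : e = (e + M • ν) - M • ν := by simp
  conv_rhs => rw [he, boundaryTerm_sub_smul hg hc h0, ← h₁ g hg fun x hx => (hW hx).1,
    ← h₂ g hg fun x hx => (hW hx).2]
  rw [← integral_const_mul, ← integral_sub (integrableOn_fderiv_apply hg hc h0 _)
    ((integrableOn_fderiv_apply hg hc h0 _).const_mul _)]
  simp

/-- Here `g` is `C¹` with compact support on all of space, so its derivative integrates to zero
(integration by parts against `1`), and it vanishes on the boundary. -/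
theorem localDivergence_inside {p : E3} (hp : p ∈ cone R.Γ) (e : E3) : R.LocalDivergence e p := by
  refine ⟨cone R.Γ, R.isOpen_cone, hp, fun g hg hc h0 hW => ?_⟩
  have hgc : ContDiff ℝ 1 g := by
    rw [contDiff_iff_contDiffAt]
    intro x
    by_cases hx : x ∈ tsupport g
    · exact (hg x (R.cone_subset_cone_closure (hW hx))).contDiffAt (R.cone_closure_mem_nhds (hW hx))
    · exact contDiffAt_const.congr_of_eventuallyEq (notMem_tsupport_iff_eventuallyEq.1 hx)
  rw [boundaryTerm_eq_zero e fun j s r hr => image_eq_zero_of_notMem_tsupport fun h =>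
    R.smul_γ_notMem_cone j hr (hW h)]
  rw [setIntegral_eq_integral_of_forall_compl_eq_zero fun x hx => by
    rw [fderiv_eq_zero_of_notMem_tsupport fun h => hx (hW h)]; rfl]
  have hi : Integrable fun x => fderiv ℝ g x e :=
    ((hgc.continuous_fderiv one_ne_zero).clm_apply continuous_const).integrable_of_hasCompactSupport
      (hc.fderiv_apply ℝ e)
  have := integral_mul_fderiv_eq_neg_fderiv_mul_of_integrable (μ := volume) (f := fun _ : E3 => (1 : ℝ))
    (g := g) (v := e) (by simp) (by simpa using hi)
    (by simpa using hgc.continuous.integrable_of_hasCompactSupport hc)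
    (fun x _ => differentiableAt_const _) (fun x _ => hgc.differentiable one_ne_zero x)
  simpa using this

theorem localDivergence_outside {p : E3} (hp0 : p ≠ 0) (hp : p ∉ cone (closure R.Γ)) (e : E3) :
    R.LocalDivergence e p := by
  have hp' : p ∈ cone (closure R.Γ)ᶜ := ⟨hp0, fun h => hp ⟨hp0, h⟩⟩
  refine ⟨cone (closure R.Γ)ᶜ, Spherical.isOpen_cone isClosed_closure.isOpen_compl, hp',
    fun g hg hc h0 hW => ?_⟩
  rw [boundaryTerm_eq_zero e fun j s r hr => image_eq_zero_of_notMem_tsupport fun h =>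
    (hW h).2 (by rw [radialProj_smul_coe hr]; exact R.γ_mem_closure j s)]
  refine setIntegral_eq_zero_of_forall_eq_zero fun x hx => ?_
  rw [fderiv_eq_zero_of_notMem_tsupport fun h => (hW h).2 (R.cone_subset_cone_closure hx).2]
  rfl

theorem localDivergence {p : E3} (hp0 : p ≠ 0) (e : E3) : R.LocalDivergence e p := by
  by_cases hp : p ∈ cone (closure R.Γ)
  · rcases R.mem_cone_closure_cases hp with h | ⟨i, s, r, hr, rfl⟩
    · exact localDivergence_inside h e
    · exact localDivergence_boundary i s hr e
  · exact localDivergence_outside hp0 hp e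

/-- The divergence theorem on the cone over a regular region, in one direction `e`. -/
theorem setIntegral_fderiv_cone {g : E3 → ℝ} (hg : ContDiffOn ℝ 1 g (cone (closure R.Γ)))
    (hc : HasCompactSupport g) (h0 : (0 : E3) ∉ tsupport g) (e : E3) :
    ∫ x in cone R.Γ, fderiv ℝ g x e = R.boundaryTerm e g := by
  have hloc : ∀ p : tsupport g, R.LocalDivergence e p := fun p =>
    localDivergence (fun h => h0 (h ▸ p.2)) e
  choose W ho hpW hW using hloc
  obtain ⟨T, hT⟩ := hc.isCompact.elim_finite_subcover W ho fun x hx =>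
    mem_iUnion.2 ⟨⟨x, hx⟩, hpW ⟨x, hx⟩⟩
  -- Indexed by a finite subcover, so the decomposition of `g` is a finite sum.
  obtain ⟨f, hf⟩ := SmoothPartitionOfUnity.exists_isSubordinate 𝓘(ℝ, E3) (isClosed_tsupport g)
    (fun p : T => W p) (fun p => ho p) (fun x hx => by
      obtain ⟨p, hpT, hp⟩ := mem_iUnion₂.1 (hT hx)
      exact mem_iUnion.2 ⟨⟨p, hpT⟩, hp⟩)
  have hsub : ∀ p : T, tsupport (fun x => f p x * g x) ⊆ tsupport g := fun p =>
    tsupport_mul_subset_right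
  have hG : ∀ p : T, ContDiffOn ℝ 1 (fun x => f p x * g x) (cone (closure R.Γ)) := fun p =>
    (((f p).contMDiff.contDiff.of_le (by exact_mod_cast le_top)).contDiffOn).mul hg
  have hGc : ∀ p : T, HasCompactSupport (fun x => f p x * g x) := fun p => hc.mul_left
  have hG0 : ∀ p : T, (0 : E3) ∉ tsupport (fun x => f p x * g x) := fun p h => h0 (hsub p h)
  have hsum : g = fun x => ∑ p, f p x * g x := by
    funext x
    rw [← Finset.sum_mul]
    by_cases hx : x ∈ tsupport g
    · rw [← finsum_eq_sum_of_fintype, f.sum_eq_one hx, one_mul]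
    · rw [image_eq_zero_of_notMem_tsupport hx, mul_zero]
  have hmain : ∀ p : T, ∫ x in cone R.Γ, fderiv ℝ (fun x => f p x * g x) x e =
      R.boundaryTerm e (fun x => f p x * g x) := fun p =>
    hW p _ (hG p) (hGc p) (hG0 p) (tsupport_mul_subset_left.trans (hf p))
  have hright : R.boundaryTerm e g = ∑ p, R.boundaryTerm e (fun x => f p x * g x) := by
    conv_lhs => rw [hsum]
    exact boundaryTerm_sum Finset.univ (fun p _ => hG p) (fun p _ => hGc p) (fun p _ => hG0 p) e
  rw [hright, ← Finset.sum_congr rfl fun p _ => hmain p,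
    ← integral_finsetSum _ fun p _ => integrableOn_fderiv_apply (hG p) (hGc p) (hG0 p) e]
  refine setIntegral_congr_fun R.isOpen_cone.measurableSet fun x hx => ?_
  have hd : ∀ p ∈ (Finset.univ : Finset T), DifferentiableAt ℝ (fun x => f p x * g x) x :=
    fun p _ => ((hG p).differentiableOn one_ne_zero).differentiableAt (R.cone_closure_mem_nhds hx)
  have := fderiv_fun_sum hd
  rw [← hsum] at this
  simp only [this, _root_.sum_apply]

end RegularRegion

/-! ### Polar coordinates and the radial weight -/

theorem surfGrad_apply (A : Set S2) (F : S2 → ℝ) (ξ : S2) (j : Fin 3) :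
    surfGrad A F ξ j =
      fderivWithin ℝ (radialExt F) (cone A) (ξ : E3) (EuclideanSpace.single j 1) := by
  have h : inner ℝ (surfGrad A F ξ) (EuclideanSpace.single j (1 : ℝ)) =
      fderivWithin ℝ (radialExt F) (cone A) (ξ : E3) (EuclideanSpace.single j 1) := by
    rw [surfGrad, gradientWithin, InnerProductSpace.toDual_symm_apply]
  rw [← h, EuclideanSpace.inner_single_right]
  simp

/-- The derivative of a function homogeneous of degree `0` is homogeneous of degree `-1`. -/
theorem fderiv_radialExt_smul (F : S2 → ℝ) {c : ℝ} (hc : 0 < c) (x : E3) :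
    fderiv ℝ (radialExt F) x = c • fderiv ℝ (radialExt F) (c • x) := by
  have h : radialExt F = fun y => radialExt F (c • y) := by
    funext y
    by_cases hy : y = 0
    · simp [hy]
    · rw [radialExt_smul hc hy]
  conv_lhs => rw [h]
  rw [fderiv_comp_smul]

/-- Integration in polar coordinates. -/
theorem setIntegral_cone {Γ : Set S2} (hΓ : IsOpen Γ) (α : ℝ → ℝ) (h : S2 → ℝ) :
    ∫ x in cone Γ, α ‖x‖ * h (radialProj x) =
      (∫ r in Ioi (0 : ℝ), r ^ 2 * α r) * ∫ η in Γ, h η ∂surfaceMeasure := by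
  have hΓm := hΓ.measurableSet
  have hcm := (isOpen_cone hΓ).measurableSet
  have h1 : ∫ x in cone Γ, α ‖x‖ * h (radialProj x) =
      ∫ x in ({0}ᶜ : Set E3), α ‖x‖ * Γ.indicator h (radialProj x) := by
    rw [← integral_indicator hcm, ← integral_indicator (measurableSet_singleton 0).compl]
    congr 1
    funext x
    by_cases hx : x = 0
    · rw [indicator_of_notMem (s := cone Γ) (fun h' => h'.1 hx),
        indicator_of_notMem (s := ({0}ᶜ : Set E3)) (fun h' => h' hx)]
    · rw [indicator_of_mem (show x ∈ ({0}ᶜ : Set E3) from hx)]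
      by_cases hxΓ : radialProj x ∈ Γ
      · rw [indicator_of_mem (show x ∈ cone Γ from ⟨hx, hxΓ⟩), indicator_of_mem hxΓ]
      · rw [indicator_of_notMem (fun h' => hxΓ h'.2), indicator_of_notMem hxΓ, mul_zero]
  rw [h1, ← integral_subtype_comap (measurableSet_singleton 0).compl
    fun x : E3 => α ‖x‖ * Γ.indicator h (radialProj x)]
  -- Polar coordinates carry Lebesgue measure to the product of the surface measure and `r² dr`.
  have h2 := (volume : Measure E3).measurePreserving_homeomorphUnitSphereProd.integral_comp
    (Homeomorph.measurableEmbedding _)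
    (fun p : S2 × Ioi (0 : ℝ) => Γ.indicator h p.1 * α p.2)
  have h3 : ∀ x : ({0}ᶜ : Set E3), α ‖(x : E3)‖ * Γ.indicator h (radialProj x) =
      Γ.indicator h (homeomorphUnitSphereProd E3 x).1 * α (homeomorphUnitSphereProd E3 x).2 := by
    intro x
    have : radialProj x = (homeomorphUnitSphereProd E3 x).1 := by
      apply Subtype.ext
      rw [coe_radialProj x.2]
      simp
    rw [this, mul_comm]
    simp
  simp only [h3]
  rw [h2, integral_prod_mul (fun η => Γ.indicator h η) (fun r : Ioi (0 : ℝ) => α r), mul_comm,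
    integral_indicator hΓm]
  congr 1
  simp only [Measure.volumeIoiPow, ENNReal.ofReal]
  rw [integral_withDensity_eq_integral_smul
    ((measurable_subtype_coe.pow_const _).real_toNNReal),
    integral_subtype_comap measurableSet_Ioi fun a : ℝ => Real.toNNReal (a ^ _) • α a]
  refine setIntegral_congr_fun measurableSet_Ioi fun x hx => ?_
  simp only [finrank_euclideanSpace_fin]
  rw [NNReal.smul_def, Real.coe_toNNReal _ (pow_nonneg (le_of_lt hx) _), smul_eq_mul]

/-- A smooth radial weight, as a function of `|x|²`. -/
noncomputable def weight : ContDiffBump (1 : ℝ) := ⟨1 / 4, 1 / 2, by norm_num, by norm_num⟩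

theorem weight_eq_zero {t : ℝ} (ht : t ∉ Icc (1 / 2 : ℝ) (3 / 2)) : weight t = 0 := by
  refine weight.zero_of_le_dist ?_
  rw [Real.dist_eq]
  change 1 / 2 ≤ _
  by_contra hcon
  rw [not_le, abs_lt] at hcon
  exact ht ⟨by linarith [hcon.1], by linarith [hcon.2]⟩

/-- The radial mass of the weight. -/
noncomputable def weightMass : ℝ := ∫ r in Ioi (0 : ℝ), r * weight (r ^ 2)

theorem contDiff_weight : ContDiff ℝ 1 weight := weight.contDiff

theorem hasCompactSupport_mul_weight (f : ℝ → ℝ) :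
    HasCompactSupport fun r : ℝ => f r * weight (r ^ 2) := by
  refine HasCompactSupport.intro (isCompact_Icc (a := (-2 : ℝ)) (b := 2)) fun r hr => ?_
  rw [weight_eq_zero, mul_zero]
  intro h
  exact hr (abs_le.1 (abs_le_of_sq_le_sq (by norm_num; linarith [h.2]) (by norm_num)))

theorem weightMass_pos : 0 < weightMass := by
  have hcont : Continuous fun r : ℝ => r * weight (r ^ 2) :=
    continuous_id.mul (weight.continuous.comp (continuous_pow 2))
  rw [weightMass, setIntegral_pos_iff_support_of_nonneg_ae]
  -- For `r` in this interval `r²` lies between `0.81` and `1.21`, within `1 / 2` of `1`, where the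
  -- weight is positive.
  · refine lt_of_lt_of_le (b := volume (Ioo (9 / 10 : ℝ) (11 / 10))) (by simp; norm_num)
      (measure_mono fun r hr => ⟨?_, ?_⟩)
    · have hr0 : 0 < r := by linarith [hr.1]
      refine (mul_pos hr0 (weight.pos_of_mem_ball ?_)).ne'
      rw [Metric.mem_ball, Real.dist_eq]
      change _ < 1 / 2
      rw [abs_lt]
      constructor <;> nlinarith [hr.1, hr.2]
    · have hr0 : 0 < r := by linarith [hr.1]
      exact hr0
  · refine (ae_restrict_iff' measurableSet_Ioi).2 (Eventually.of_forall fun r hr => ?_)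
    exact mul_nonneg (le_of_lt hr) weight.nonneg
  · exact (hcont.integrable_of_hasCompactSupport (hasCompactSupport_mul_weight _)).integrableOn

/-- `r² χ(r²)` vanishes at `0` and for large `r`, so its derivative integrates to zero. This is the
source of the factor `2` before `∫ η · v`. -/
theorem integral_deriv_weight :
    ∫ r in Ioi (0 : ℝ), r ^ 2 * (2 * r * deriv weight (r ^ 2)) = -2 * weightMass := by
  have hc : ContDiff ℝ 1 fun r : ℝ => r ^ 2 * weight (r ^ 2) :=
    (contDiff_id.pow 2).mul (contDiff_weight.comp (contDiff_id.pow 2))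
  have h := HasCompactSupport.integral_Ioi_deriv_eq hc (hasCompactSupport_mul_weight _) 0
  have hd : ∀ r : ℝ, deriv (fun r : ℝ => r ^ 2 * weight (r ^ 2)) r =
      r ^ 2 * (2 * r * deriv weight (r ^ 2)) + 2 * (r * weight (r ^ 2)) := by
    intro r
    have h1 : HasDerivAt (fun r : ℝ => r ^ 2) (2 * r) r := by simpa using hasDerivAt_pow 2 r
    have h2 : HasDerivAt weight (deriv weight (r ^ 2)) (r ^ 2) :=
      (contDiff_weight.differentiable one_ne_zero _).hasDerivAt
    refine (h1.mul (HasDerivAt.comp (h := fun r : ℝ => r ^ 2) r h2 h1)).deriv.trans ?_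
    simp only [Function.comp]
    ring
  have hi2 : Integrable fun r : ℝ => r * weight (r ^ 2) :=
    (continuous_id.mul (weight.continuous.comp (continuous_pow 2))).integrable_of_hasCompactSupport
      (hasCompactSupport_mul_weight _)
  have hi1 : Integrable (deriv fun r : ℝ => r ^ 2 * weight (r ^ 2)) :=
    (hc.continuous_deriv le_rfl).integrable_of_hasCompactSupport
      (hasCompactSupport_mul_weight _).deriv
  have h3 : ∀ r : ℝ, r ^ 2 * (2 * r * deriv weight (r ^ 2)) =
      deriv (fun r : ℝ => r ^ 2 * weight (r ^ 2)) r - 2 * (r * weight (r ^ 2)) := fun r => by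
    rw [hd]
    ring
  simp only [h3]
  rw [integral_sub hi1.integrableOn (hi2.const_mul 2).integrableOn, h, integral_const_mul]
  simp [weightMass]

/-! ### From the cone to the sphere -/

namespace RegularRegion
variable {R : RegularRegion}

theorem integrableOn_cone {h : E3 → ℝ} (hh : ContinuousOn h (cone (closure R.Γ))) {K : Set E3}
    (hK : IsCompact K) (h0 : (0 : E3) ∉ K) (hz : ∀ x, x ∉ K → h x = 0) :
    IntegrableOn h (cone R.Γ) := by
  have h1 := (hh.mono inter_subset_right).integrableOn_compact
    (isCompact_inter_cone isClosed_closure hK h0) (μ := volume)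
  refine h1.of_forall_sdiff_eq_zero R.isOpen_cone.measurableSet fun x hx => hz x fun hxK => ?_
  exact hx.2 ⟨hxK, R.cone_subset_cone_closure hx.1⟩

theorem continuousOn_of_radialExt {F : S2 → ℝ} {A : Set S2}
    (hF : ContinuousOn (radialExt F) (cone A)) : ContinuousOn F A := by
  have := hF.comp (f := fun ξ : S2 => (ξ : E3)) continuous_subtype_val.continuousOn
    (s := A) fun ξ hξ => coe_mem_cone_iff.2 hξ
  exact this.congr fun ξ _ => (radialExt_coe F ξ).symm

theorem continuous_comp_γ {F : S2 → ℝ} (hF : ContinuousOn F (closure R.Γ)) (i : Fin R.n) :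
    Continuous fun s => F (R.γ i s) :=
  hF.comp_continuous (R.continuous_γ i) (R.γ_mem_closure i)

/-- The shell that carries the weight. -/
def shell : Set E3 := {x | ‖x‖ ^ 2 ∈ Icc (1 / 2 : ℝ) (3 / 2)}

theorem isCompact_shell : IsCompact shell := by
  refine (isCompact_closedBall (0 : E3) 2).of_isClosed_subset
    (isClosed_Icc.preimage (continuous_norm.pow 2)) fun x hx => ?_
  rw [mem_closedBall_zero_iff]
  exact le_of_sq_le_sq (by linarith [hx.2]) (by norm_num)

theorem zero_notMem_shell : (0 : E3) ∉ shell := fun h => by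
  have := h.1
  norm_num at this

/-- The divergence theorem on a regular region of the sphere. -/
theorem integral_surfDiv {v : S2 → E3}
    (hv : ∀ j, ContDiffOn ℝ 1 (radialExt fun η => v η j) (cone (closure R.Γ))) :
    ∫ η in R.Γ, surfDiv (closure R.Γ) v η ∂surfaceMeasure =
      (∑ i, ∫ s in (0 : ℝ)..R.len i, inner ℝ (R.nu i s) (v (R.γ i s))) +
        2 * ∫ η in R.Γ, inner ℝ (η : E3) (v η) ∂surfaceMeasure := by
  set C := cone (closure R.Γ) with hC
  set g : Fin 3 → E3 → ℝ := fun j x => weight (‖x‖ ^ 2) * radialExt (fun η => v η j) x with hgdef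
  have hχ : ContDiff ℝ 1 fun x : E3 => weight (‖x‖ ^ 2) := contDiff_weight.comp (contDiff_norm_sq ℝ)
  have hg : ∀ j, ContDiffOn ℝ 1 (g j) C := fun j => hχ.contDiffOn.mul (hv j)
  have hgt : ∀ j, tsupport (g j) ⊆ shell := fun j => by
    refine closure_minimal (fun x hx => ?_) isCompact_shell.isClosed
    by_contra hcon
    exact hx (by simp only [hgdef]; rw [weight_eq_zero hcon, zero_mul])
  have hgc : ∀ j, HasCompactSupport (g j) := fun j =>
    isCompact_shell.of_isClosed_subset (isClosed_tsupport _) (hgt j)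
  have hg0 : ∀ j, (0 : E3) ∉ tsupport (g j) := fun j h => zero_notMem_shell (hgt j h)
  let ε : Fin 3 → E3 := fun j => EuclideanSpace.single j 1
  have hdiv : ∑ j, ∫ x in cone R.Γ, fderiv ℝ (g j) x (ε j) = ∑ j, R.boundaryTerm (ε j) (g j) :=
    Finset.sum_congr rfl fun j _ => setIntegral_fderiv_cone (hg j) (hgc j) (hg0 j) _
  -- the left side in polar coordinates
  have hχd : ∀ x : E3, HasFDerivAt (fun x : E3 => weight (‖x‖ ^ 2))
      (deriv weight (‖x‖ ^ 2) • (2 • innerSL ℝ x)) x := fun x =>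
    (contDiff_weight.differentiable one_ne_zero _).hasDerivAt.comp_hasFDerivAt x
      (hasStrictFDerivAt_norm_sq x).hasFDerivAt
  set p₁ : E3 → ℝ := fun x => (2 * ‖x‖ * deriv weight (‖x‖ ^ 2)) *
    inner ℝ (radialProj x : E3) (v (radialProj x)) with hp₁
  set p₂ : E3 → ℝ := fun x => (‖x‖⁻¹ * weight (‖x‖ ^ 2)) *
    surfDiv (closure R.Γ) v (radialProj x) with hp₂
  have hpt : ∀ x ∈ cone R.Γ, ∑ j, fderiv ℝ (g j) x (ε j) = p₁ x + p₂ x := by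
    intro x hx
    have hx0 : x ≠ 0 := hx.1
    have hn : 0 < ‖x‖ := norm_pos_iff.2 hx0
    -- Product rule: `χ(|x|²)` has gradient `2χ' x`, and the derivative of the radial extension at
    -- `x` is `|x|⁻¹` times that at `x/|x|`.
    have hterm : ∀ j, fderiv ℝ (g j) x (ε j) =
        2 * ‖x‖ * deriv weight (‖x‖ ^ 2) * ((radialProj x : E3) j * v (radialProj x) j) +
        ‖x‖⁻¹ * weight (‖x‖ ^ 2) *
          surfGrad (closure R.Γ) (fun η => v η j) (radialProj x) j := by
      intro j
      have hd : HasFDerivAt (radialExt fun η => v η j) (fderiv ℝ (radialExt fun η => v η j) x) x :=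
        (((hv j).differentiableOn one_ne_zero).differentiableAt
          (R.cone_closure_mem_nhds hx)).hasFDerivAt
      have h1 := ((hχd x).mul hd).fderiv
      have h2 : fderiv ℝ (g j) x = _ := h1
      have hmem : (radialProj x : E3) ∈ cone R.Γ := coe_mem_cone_iff.2 hx.2
      have h3 : x j = ‖x‖ * (radialProj x : E3) j := by
        conv_lhs => rw [← norm_smul_radialProj hx0]
        simp
      rw [h2, surfGrad_apply, fderivWithin_eq hmem,
        fderiv_radialExt_smul _ (inv_pos.2 hn) x, ← coe_radialProj hx0]
      simp [ε, EuclideanSpace.inner_single_right]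
      rw [h3, radialExt]
      ring
    simp only [hterm, Finset.sum_add_distrib, ← Finset.mul_sum, hp₁, hp₂, surfDiv]
    congr 2
    simp [PiLp.inner_apply, mul_comm]
  have hp₁i : IntegrableOn p₁ (cone R.Γ) := by
    refine integrableOn_cone ?_ isCompact_shell zero_notMem_shell ?_
    · have hin : ∀ x ∈ C, inner ℝ (radialProj x : E3) (v (radialProj x)) =
          ∑ j, (radialProj x : E3) j * radialExt (fun η => v η j) x := fun x _ => by
        simp [PiLp.inner_apply, radialExt, mul_comm]
      refine ContinuousOn.mul ?_ (ContinuousOn.congr ?_ hin)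
      · have : Continuous (deriv weight) := contDiff_weight.continuous_deriv le_rfl
        fun_prop
      · refine continuousOn_finsetSum _ fun j _ => ContinuousOn.mul ?_ (hv j).continuousOn
        have h1 : ContinuousOn (fun x => (radialProj x : E3)) C :=
          continuous_subtype_val.comp_continuousOn (continuousOn_radialProj.mono fun x hx => hx.1)
        exact (EuclideanSpace.proj (𝕜 := ℝ) j : E3 →L[ℝ] ℝ).continuous.comp_continuousOn h1
    · intro x hx
      have : deriv weight (‖x‖ ^ 2) = 0 := by
        refine image_eq_zero_of_notMem_tsupport fun h => hx ?_
        have h2 := tsupport_deriv_subset (𝕜 := ℝ) (f := weight) h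
        refine closure_minimal (fun t ht => ?_) isClosed_Icc h2
        by_contra hcon
        exact ht (weight_eq_zero hcon)
      simp [hp₁, this]
  have hsumi : IntegrableOn (fun x => ∑ j, fderiv ℝ (g j) x (ε j)) (cone R.Γ) :=
    integrable_finsetSum _ fun j _ => integrableOn_fderiv_apply (hg j) (hgc j) (hg0 j) _
  have hleft : ∑ j, ∫ x in cone R.Γ, fderiv ℝ (g j) x (ε j) =
      (∫ x in cone R.Γ, p₁ x) + ∫ x in cone R.Γ, p₂ x := by
    -- Integrable as the difference of the full divergence and `p₁`.
    have hp₂i : IntegrableOn p₂ (cone R.Γ) :=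
      (hsumi.sub hp₁i).congr_fun (fun x hx => by simp [hpt x hx]) R.isOpen_cone.measurableSet
    rw [← integral_finsetSum _ fun j _ => integrableOn_fderiv_apply (hg j) (hgc j) (hg0 j) _,
      ← integral_add hp₁i hp₂i]
    exact setIntegral_congr_fun R.isOpen_cone.measurableSet hpt
  have hpol₁ := setIntegral_cone R.isOpen (fun r => 2 * r * deriv weight (r ^ 2))
    (fun η => inner ℝ (η : E3) (v η))
  have hpol₂ := setIntegral_cone R.isOpen (fun r => r⁻¹ * weight (r ^ 2))
    (surfDiv (closure R.Γ) v)
  rw [integral_deriv_weight] at hpol₁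
  have hmass : ∫ r in Ioi (0 : ℝ), r ^ 2 * (r⁻¹ * weight (r ^ 2)) = weightMass :=
    setIntegral_congr_fun measurableSet_Ioi fun r hr => by
      have : r ≠ 0 := ne_of_gt hr
      field_simp
  rw [hmass] at hpol₂
  -- the right side
  have hright : ∑ j, R.boundaryTerm (ε j) (g j) =
      weightMass * ∑ i, ∫ s in (0 : ℝ)..R.len i, inner ℝ (R.nu i s) (v (R.γ i s)) := by
    simp only [boundaryTerm]
    rw [Finset.sum_comm, Finset.mul_sum]
    refine Finset.sum_congr rfl fun i _ => ?_
    -- The radial extension is constant along the ray, so only the mass `∫ r χ(r²) dr` depends on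
    -- `r`.
    have hin : ∀ j s, ∫ r in Ioi (0 : ℝ), r * g j (r • (R.γ i s : E3)) * inner ℝ (ε j) (R.nu i s) =
        weightMass * (R.nu i s j * v (R.γ i s) j) := by
      intro j s
      rw [weightMass, ← integral_mul_const]
      refine setIntegral_congr_fun measurableSet_Ioi fun r hr => ?_
      simp only [hgdef, radialExt_smul_coe _ (show 0 < r from hr), norm_smul, norm_coe, mul_one,
        Real.norm_of_nonneg (le_of_lt hr), ε, EuclideanSpace.inner_single_left]
      simp
      ring
    simp only [hin]
    rw [← intervalIntegral.integral_finsetSum, ← intervalIntegral.integral_const_mul]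
    · refine intervalIntegral.integral_congr fun s _ => ?_
      simp [PiLp.inner_apply, Finset.mul_sum, mul_comm]
    · intro j _
      refine Continuous.intervalIntegrable ?_ _ _
      have h1 : Continuous fun s => v (R.γ i s) j :=
        continuous_comp_γ (continuousOn_of_radialExt (hv j).continuousOn) i
      have h2 : Continuous fun s => R.nu i s j :=
        (EuclideanSpace.proj (𝕜 := ℝ) j : E3 →L[ℝ] ℝ).continuous.comp (R.continuous_nu i)
      exact continuous_const.mul (h2.mul h1)
  rw [hleft, hright, hpol₁, hpol₂] at hdiv
  -- With `m` the radial mass, `hdiv` reads `-2m ∫ η · v + m ∫ ∇* · v = m ∮ ν · v`.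
  refine mul_left_cancel₀ weightMass_pos.ne' ?_
  linear_combination hdiv

/-- On one half-open period each curve is a measurable embedding. Hence `G` need only be continuous
along the curves, which matters because `normal` and `tangent` are chosen pointwise on the sphere.
-/
theorem integral_lineMeasure {G : S2 → ℝ} (hG : ∀ i, Continuous fun s => G (R.γ i s)) :
    ∫ η in frontier R.Γ, G η ∂(R.lineMeasure) = ∑ i, ∫ s in (0 : ℝ)..R.len i, G (R.γ i s) := by
  have hemb : ∀ i, MeasurableEmbedding ((Ioc 0 (R.len i)).domRestrict (R.γ i)) := fun i => by
    refine (R.continuous_γ i).continuousOn.measurableEmbedding measurableSet_Ioc ?_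
    intro x hx y hy h
    -- Two points of `(0, len]` differ by less than a period, so a half-open period starting at the
    -- smaller one contains both.
    refine R.injOn_Ico i (min x y) ⟨min_le_left _ _, ?_⟩ ⟨min_le_right _ _, ?_⟩ h
    · rcases min_choice x y with h | h <;> rw [h] <;> linarith [hx.1, hx.2, hy.1, hy.2]
    · rcases min_choice x y with h | h <;> rw [h] <;> linarith [hx.1, hx.2, hy.1, hy.2]
  have hmap : ∀ i, (volume.restrict (Ioc 0 (R.len i))).map (R.γ i) =
      (volume.comap ((↑) : Ioc 0 (R.len i) → ℝ)).map ((Ioc 0 (R.len i)).domRestrict (R.γ i)) := by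
    intro i
    rw [← map_comap_subtype_coe measurableSet_Ioc,
      Measure.map_map (R.continuous_γ i).measurable measurable_subtype_coe]
    rfl
  have hres : R.lineMeasure.restrict (frontier R.Γ) = R.lineMeasure := by
    refine Measure.restrict_eq_self_of_ae_mem ?_
    rw [lineMeasure, ← Measure.sum_fintype, Measure.ae_sum_iff]
    intro i
    exact (ae_map_iff (p := fun x => x ∈ frontier R.Γ) (R.continuous_γ i).measurable.aemeasurable
      isClosed_frontier.measurableSet).2 (Eventually.of_forall fun s => R.γ_mem_frontier i s)
  rw [hres, lineMeasure, integral_finsetSum_measure]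
  · refine Finset.sum_congr rfl fun i _ => ?_
    rw [hmap, (hemb i).integral_map, intervalIntegral.integral_of_le (R.len_pos i).le]
    exact integral_subtype_comap measurableSet_Ioc fun s => G (R.γ i s)
  · intro i _
    rw [hmap, (hemb i).integrable_map_iff]
    exact (integrableOn_iff_comap_subtypeVal measurableSet_Ioc).1
      (((hG i).integrableOn_Icc (a := 0) (b := R.len i)).mono_set Ioc_subset_Icc_self)

end RegularRegion

/-! ### Rules for the surface operators -/

theorem hasFDerivAt_norm_coe (ξ : S2) :
    HasFDerivAt (fun x : E3 => ‖x‖) (innerSL ℝ (ξ : E3)) (ξ : E3) := by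
  have h := (hasStrictFDerivAt_norm_sq (ξ : E3)).hasFDerivAt.sqrt (by simp)
  simp only [Real.sqrt_sq (norm_nonneg _), norm_coe] at h
  refine h.congr_fderiv (ContinuousLinearMap.ext fun y => ?_)
  simp

theorem contDiffOn_coe_radialProj (n : ℕ∞) :
    ContDiffOn ℝ n (fun x : E3 => (radialProj x : E3)) {0}ᶜ := by
  have hc : ContDiffOn ℝ n (fun x : E3 => ‖x‖⁻¹ • x) {0}ᶜ := fun x hx =>
    (((contDiffAt_norm ℝ hx).inv (norm_ne_zero_iff.2 hx)).smul contDiffAt_id).contDiffWithinAt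
  exact hc.congr fun x hx => coe_radialProj hx

/-- At a unit vector, `x_l / |x|` has as gradient the tangential projection of the `l`-th basis
vector. The symmetry in `l` and `j` is used in `surfDiv_cross`. -/
theorem fderiv_radialExt_coord (ξ : S2) (l j : Fin 3) :
    fderiv ℝ (radialExt fun η => (η : E3) l) (ξ : E3) (EuclideanSpace.single j 1) =
      (if l = j then 1 else 0) - (ξ : E3) l * (ξ : E3) j := by
  have h1 : HasFDerivAt (fun x : E3 => ‖x‖⁻¹) (-innerSL ℝ (ξ : E3)) (ξ : E3) := by
    have := (hasDerivAt_inv (norm_ne_zero_iff.2 (coe_ne_zero ξ))).comp_hasFDerivAt (ξ : E3)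
      (hasFDerivAt_norm_coe ξ)
    refine this.congr_fderiv (ContinuousLinearMap.ext fun y => ?_)
    simp
  have h2 : HasFDerivAt (fun x : E3 => x l) (EuclideanSpace.proj (𝕜 := ℝ) l : E3 →L[ℝ] ℝ) (ξ : E3) :=
    (EuclideanSpace.proj (𝕜 := ℝ) l : E3 →L[ℝ] ℝ).hasFDerivAt
  have h3 : (radialExt fun η => (η : E3) l) =ᶠ[𝓝 (ξ : E3)] fun x => ‖x‖⁻¹ * x l := by
    filter_upwards [isOpen_compl_singleton.mem_nhds (coe_ne_zero ξ)] with x hx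
    simp [radialExt, coe_radialProj hx]
  rw [h3.fderiv_eq, (h1.fun_mul h2).fderiv]
  simp [EuclideanSpace.inner_single_right]
  ring

theorem inner_surfGrad (A : Set S2) (F : S2 → ℝ) (ξ : S2) (w : E3) :
    inner ℝ w (surfGrad A F ξ) = fderivWithin ℝ (radialExt F) (cone A) (ξ : E3) w := by
  rw [surfGrad, gradientWithin, real_inner_comm, InnerProductSpace.toDual_symm_apply]

namespace RegularRegion
variable {R : RegularRegion}

theorem differentiableAt_radialExt {F : S2 → ℝ}
    (hF : ContDiffOn ℝ 1 (radialExt F) (cone (closure R.Γ))) {ξ : S2} (hξ : ξ ∈ R.Γ) :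
    DifferentiableAt ℝ (radialExt F) (ξ : E3) :=
  (hF.differentiableOn one_ne_zero).differentiableAt
    (R.cone_closure_mem_nhds (coe_mem_cone_iff.2 hξ))

theorem surfGrad_mul {F G : S2 → ℝ} (hF : ContDiffOn ℝ 1 (radialExt F) (cone (closure R.Γ)))
    (hG : ContDiffOn ℝ 1 (radialExt G) (cone (closure R.Γ))) {ξ : S2} (hξ : ξ ∈ R.Γ) (j : Fin 3) :
    surfGrad (closure R.Γ) (fun η => F η * G η) ξ j =
      F ξ * surfGrad (closure R.Γ) G ξ j + G ξ * surfGrad (closure R.Γ) F ξ j := by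
  have hmem : (ξ : E3) ∈ cone R.Γ := coe_mem_cone_iff.2 hξ
  have h := fderiv_fun_mul (differentiableAt_radialExt hF hξ) (differentiableAt_radialExt hG hξ)
  simp only [surfGrad_apply, fderivWithin_eq hmem]
  change fderiv ℝ (fun x => radialExt F x * radialExt G x) _ _ = _
  rw [h]
  simp [radialExt_coe]

theorem surfGrad_sub {F G : S2 → ℝ} (hF : ContDiffOn ℝ 1 (radialExt F) (cone (closure R.Γ)))
    (hG : ContDiffOn ℝ 1 (radialExt G) (cone (closure R.Γ))) {ξ : S2} (hξ : ξ ∈ R.Γ) (j : Fin 3) :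
    surfGrad (closure R.Γ) (fun η => F η - G η) ξ j =
      surfGrad (closure R.Γ) F ξ j - surfGrad (closure R.Γ) G ξ j := by
  have hmem : (ξ : E3) ∈ cone R.Γ := coe_mem_cone_iff.2 hξ
  have h := fderiv_fun_sub (differentiableAt_radialExt hF hξ) (differentiableAt_radialExt hG hξ)
  simp only [surfGrad_apply, fderivWithin_eq hmem]
  change fderiv ℝ (fun x => radialExt F x - radialExt G x) _ _ = _
  rw [h]
  simp

theorem contDiffOn_radialExt_coord (l : Fin 3) :
    ContDiffOn ℝ 1 (radialExt fun η => (η : E3) l) (cone (closure R.Γ)) :=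
  (EuclideanSpace.proj (𝕜 := ℝ) l : E3 →L[ℝ] ℝ).contDiff.comp_contDiffOn
    ((contDiffOn_coe_radialProj 1).mono fun _ hx => hx.1)

theorem surfGrad_coord {ξ : S2} (hξ : ξ ∈ R.Γ) (l j : Fin 3) :
    surfGrad (closure R.Γ) (fun η => (η : E3) l) ξ j =
      (if l = j then 1 else 0) - (ξ : E3) l * (ξ : E3) j := by
  rw [surfGrad_apply, fderivWithin_eq (coe_mem_cone_iff.2 hξ), fderiv_radialExt_coord]

theorem continuousOn_surfGrad {F : S2 → ℝ}
    (hF : ContDiffOn ℝ 1 (radialExt F) (cone (closure R.Γ))) :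
    ContinuousOn (surfGrad (closure R.Γ) F) (closure R.Γ) := by
  have h1 := hF.continuousOn_fderivWithin R.uniqueDiffOn_cone_closure le_rfl
  have h2 := h1.comp (f := fun ξ : S2 => (ξ : E3)) continuous_subtype_val.continuousOn
    (s := closure R.Γ) fun ξ hξ => coe_mem_cone_iff.2 hξ
  exact (InnerProductSpace.toDual ℝ E3).symm.continuous.comp_continuousOn h2

theorem continuousOn_vec {v : S2 → E3}
    (hv : ∀ j, ContDiffOn ℝ 1 (radialExt fun η => v η j) (cone (closure R.Γ))) :
    ContinuousOn v (closure R.Γ) := by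
  have h := continuousOn_pi.2 fun j => continuousOn_of_radialExt (hv j).continuousOn
  exact (PiLp.continuous_toLp 2 _).comp_continuousOn h

theorem continuousOn_surfDiv {v : S2 → E3}
    (hv : ∀ j, ContDiffOn ℝ 1 (radialExt fun η => v η j) (cone (closure R.Γ))) :
    ContinuousOn (surfDiv (closure R.Γ) v) (closure R.Γ) :=
  continuousOn_finsetSum _ fun j _ =>
    (EuclideanSpace.proj (𝕜 := ℝ) j : E3 →L[ℝ] ℝ).continuous.comp_continuousOn
      (continuousOn_surfGrad (hv j))

theorem continuousOn_surfCurlGrad {F : S2 → ℝ}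
    (hF : ContDiffOn ℝ 1 (radialExt F) (cone (closure R.Γ))) :
    ContinuousOn (surfCurlGrad (closure R.Γ) F) (closure R.Γ) :=
  continuous_cross.comp_continuousOn
    (continuous_subtype_val.continuousOn.prodMk (continuousOn_surfGrad hF))

theorem continuousOn_surfCurl {v : S2 → E3}
    (hv : ∀ j, ContDiffOn ℝ 1 (radialExt fun η => v η j) (cone (closure R.Γ))) :
    ContinuousOn (surfCurl (closure R.Γ) v) (closure R.Γ) :=
  continuousOn_finsetSum _ fun j _ =>
    (EuclideanSpace.proj (𝕜 := ℝ) j : E3 →L[ℝ] ℝ).continuous.comp_continuousOn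
      (continuousOn_surfCurlGrad (hv j))

theorem integrableOn_region {h : S2 → ℝ} (hh : ContinuousOn h (closure R.Γ)) :
    IntegrableOn h R.Γ surfaceMeasure := by
  have : IsFiniteMeasure surfaceMeasure :=
    inferInstanceAs (IsFiniteMeasure (volume : Measure E3).toSphere)
  exact (hh.integrableOn_compact isClosed_closure.isCompact).mono_set subset_closure

/-! ### Integral theorems and Green's formulas -/

/-- The surface divergence theorem, for fields that need not be tangential. -/
theorem integral_surfDiv_eq {v : S2 → E3}
    (hv : ∀ j, ContDiffOn ℝ 1 (radialExt fun η => v η j) (cone (closure R.Γ))) :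
    ∫ η in R.Γ, surfDiv (closure R.Γ) v η ∂surfaceMeasure =
      (∫ η in frontier R.Γ, inner ℝ (R.normal η) (v η) ∂(R.lineMeasure)) +
        2 * ∫ η in R.Γ, inner ℝ (η : E3) (v η) ∂surfaceMeasure := by
  rw [integral_surfDiv hv, integral_lineMeasure]
  · simp only [normal_apply]
  · intro i
    simp only [normal_apply]
    exact (R.continuous_nu i).inner ((continuousOn_vec hv).comp_continuous (R.continuous_γ i)
      (R.γ_mem_closure i))

theorem radialExt_cross_contDiffOn {v : S2 → E3}
    (hv : ∀ j, ContDiffOn ℝ 1 (radialExt fun η => v η j) (cone (closure R.Γ))) (j : Fin 3) :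
    ContDiffOn ℝ 1 (radialExt fun η => cross (v η) (η : E3) j) (cone (closure R.Γ)) := by
  have h : ∀ k l : Fin 3, ContDiffOn ℝ 1
      (fun x => radialExt (fun η => v η k) x * radialExt (fun η => (η : E3) l) x)
      (cone (closure R.Γ)) := fun k l => (hv k).mul (contDiffOn_radialExt_coord l)
  simp only [cross_apply]
  fin_cases j
  · exact (h 1 2).sub (h 2 1)
  · exact (h 2 0).sub (h 0 2)
  · exact (h 0 1).sub (h 1 0)

/-- By the product rule `∇* · (v ∧ ξ) = ξ · (∇* ∧ v) - v · (∇* ∧ ξ)`. The first term is `L* · v`;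
the second vanishes because `δ_lj - ξ_l ξ_j` is symmetric. -/
theorem surfDiv_cross {v : S2 → E3}
    (hv : ∀ j, ContDiffOn ℝ 1 (radialExt fun η => v η j) (cone (closure R.Γ))) {ξ : S2}
    (hξ : ξ ∈ R.Γ) :
    surfDiv (closure R.Γ) (fun η => cross (v η) (η : E3)) ξ = surfCurl (closure R.Γ) v ξ := by
  have hc : ∀ k l : Fin 3, ContDiffOn ℝ 1
      (radialExt fun η => v η k * (η : E3) l) (cone (closure R.Γ)) :=
    fun k l => (hv k).mul (contDiffOn_radialExt_coord l)
  have h : ∀ k l m n j : Fin 3,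
      surfGrad (closure R.Γ) (fun η => v η k * (η : E3) l - v η m * (η : E3) n) ξ j =
      (v ξ k * ((if l = j then 1 else 0) - (ξ : E3) l * (ξ : E3) j) +
        (ξ : E3) l * surfGrad (closure R.Γ) (fun η => v η k) ξ j) -
      (v ξ m * ((if n = j then 1 else 0) - (ξ : E3) n * (ξ : E3) j) +
        (ξ : E3) n * surfGrad (closure R.Γ) (fun η => v η m) ξ j) := fun k l m n j => by
    rw [surfGrad_sub (hc k l) (hc m n) hξ,
      surfGrad_mul (hv k) (contDiffOn_radialExt_coord l) hξ,
      surfGrad_mul (hv m) (contDiffOn_radialExt_coord n) hξ, surfGrad_coord hξ, surfGrad_coord hξ]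
  simp only [surfDiv, surfCurl, surfCurlGrad, Fin.sum_univ_three, cross_apply]
  simp [h]
  ring

/-- The surface curl theorem. -/
theorem integral_surfCurl_eq {v : S2 → E3}
    (hv : ∀ j, ContDiffOn ℝ 1 (radialExt fun η => v η j) (cone (closure R.Γ))) :
    ∫ η in R.Γ, surfCurl (closure R.Γ) v η ∂surfaceMeasure =
      ∫ η in frontier R.Γ, inner ℝ (R.tangent η) (v η) ∂(R.lineMeasure) := by
  rw [← setIntegral_congr_fun R.isOpen.measurableSet fun ξ hξ => surfDiv_cross hv hξ,
    integral_surfDiv_eq (radialExt_cross_contDiffOn hv)]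
  -- `v ∧ η` is tangential, so the radial term drops out.
  have h1 : ∀ η : S2, inner ℝ (η : E3) (cross (v η) (η : E3)) = 0 := fun η => by
    simp [inner_eq, cross_apply]
    ring
  simp only [h1, integral_zero, mul_zero, add_zero]
  refine setIntegral_congr_fun isClosed_frontier.measurableSet fun η hη => ?_
  rw [R.frontier_eq] at hη
  obtain ⟨i, s, rfl⟩ := mem_iUnion.1 hη
  have h2 := R.inner_γ_deriv i s
  have h3 : inner ℝ (R.γ i s : E3) (R.γ i s : E3) = 1 := by
    rw [real_inner_self_eq_norm_sq, norm_coe, one_pow]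
  simp only [normal, R.tangent_apply]
  generalize deriv (fun t => (R.γ i t : E3)) s = a at *
  generalize v (R.γ i s) = w at *
  generalize (R.γ i s : E3) = b at *
  simp only [inner_eq, cross_apply] at *
  simp
  -- `(τ ∧ η) · (v ∧ η) = (τ · v)(η · η) - (τ · η)(η · v) = τ · v`.
  linear_combination (a 0 * w 0 + a 1 * w 1 + a 2 * w 2) * h3 -
    (b 0 * w 0 + b 1 * w 1 + b 2 * w 2) * h2

theorem radialExt_smul_contDiffOn {F : S2 → ℝ} {f : S2 → E3}
    (hF : ContDiffOn ℝ 1 (radialExt F) (cone (closure R.Γ)))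
    (hf : ∀ j, ContDiffOn ℝ 1 (radialExt fun η => f η j) (cone (closure R.Γ))) (j : Fin 3) :
    ContDiffOn ℝ 1 (radialExt fun η => (F η • f η) j) (cone (closure R.Γ)) :=
  hF.mul (hf j)

/-- Green's formula for the surface gradient and the surface divergence. -/
theorem integral_inner_surfGrad_add {F : S2 → ℝ} {f : S2 → E3}
    (hF : ContDiffOn ℝ 1 (radialExt F) (cone (closure R.Γ)))
    (hf : ∀ j, ContDiffOn ℝ 1 (radialExt fun η => f η j) (cone (closure R.Γ))) :
    (∫ η in R.Γ, inner ℝ (f η) (surfGrad (closure R.Γ) F η) ∂surfaceMeasure) +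
        (∫ η in R.Γ, F η * surfDiv (closure R.Γ) f η ∂surfaceMeasure) =
      (∫ η in frontier R.Γ, inner ℝ (R.normal η) (F η • f η) ∂(R.lineMeasure)) +
        2 * ∫ η in R.Γ, inner ℝ (η : E3) (F η • f η) ∂surfaceMeasure := by
  have hi : IntegrableOn (fun η => F η * surfDiv (closure R.Γ) f η) R.Γ surfaceMeasure :=
    integrableOn_region ((continuousOn_of_radialExt hF.continuousOn).mul (continuousOn_surfDiv hf))
  rw [← integral_surfDiv_eq (radialExt_smul_contDiffOn hF hf), ← integral_add
    (integrableOn_region ((continuousOn_vec hf).inner (continuousOn_surfGrad hF))) hi]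
  refine setIntegral_congr_fun R.isOpen.measurableSet fun ξ hξ => ?_
  -- The divergence theorem was applied to `F f`; the product rule splits its divergence.
  have h : ∀ j, surfGrad (closure R.Γ) (fun η => (F η • f η) j) ξ j = _ :=
    fun j => surfGrad_mul hF (hf j) hξ j
  simp only [surfDiv, h, Fin.sum_univ_three, inner_eq]
  ring

/-- Green's formula for the surface curl gradient and the surface curl. -/
theorem integral_inner_surfCurlGrad_add {F : S2 → ℝ} {f : S2 → E3}
    (hF : ContDiffOn ℝ 1 (radialExt F) (cone (closure R.Γ)))
    (hf : ∀ j, ContDiffOn ℝ 1 (radialExt fun η => f η j) (cone (closure R.Γ))) :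
    (∫ η in R.Γ, inner ℝ (f η) (surfCurlGrad (closure R.Γ) F η) ∂surfaceMeasure) +
        (∫ η in R.Γ, F η * surfCurl (closure R.Γ) f η ∂surfaceMeasure) =
      ∫ η in frontier R.Γ, inner ℝ (R.tangent η) (F η • f η) ∂(R.lineMeasure) := by
  have hi : IntegrableOn (fun η => F η * surfCurl (closure R.Γ) f η) R.Γ surfaceMeasure :=
    integrableOn_region ((continuousOn_of_radialExt hF.continuousOn).mul (continuousOn_surfCurl hf))
  rw [← integral_surfCurl_eq (radialExt_smul_contDiffOn hF hf), ← integral_add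
    (integrableOn_region ((continuousOn_vec hf).inner (continuousOn_surfCurlGrad hF))) hi]
  refine setIntegral_congr_fun R.isOpen.measurableSet fun ξ hξ => ?_
  have h : ∀ j k, surfGrad (closure R.Γ) (fun η => (F η • f η) j) ξ k = _ :=
    fun j k => surfGrad_mul hF (hf j) hξ k
  simp only [surfCurl, surfCurlGrad, Fin.sum_univ_three, inner_eq, cross_apply]
  simp only [h]
  simp
  ring

/-- The radial extension is constant along the ray through `ξ`. -/
theorem inner_coe_surfGrad {F : S2 → ℝ}
    (hF : ContDiffOn ℝ 1 (radialExt F) (cone (closure R.Γ))) {ξ : S2} (hξ : ξ ∈ R.Γ) :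
    inner ℝ (ξ : E3) (surfGrad (closure R.Γ) F ξ) = 0 := by
  rw [inner_surfGrad, fderivWithin_eq (coe_mem_cone_iff.2 hξ)]
  have h1 : HasDerivAt (fun t : ℝ => t • (ξ : E3)) (ξ : E3) 1 := by
    simpa using (hasDerivAt_id (1 : ℝ)).smul_const (ξ : E3)
  have h2 : HasFDerivAt (radialExt F) (fderiv ℝ (radialExt F) (ξ : E3)) ((1 : ℝ) • (ξ : E3)) := by
    rw [one_smul]
    exact (differentiableAt_radialExt hF hξ).hasFDerivAt
  have h3 := h2.comp_hasDerivAt (1 : ℝ) h1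
  have h4 : (radialExt F ∘ fun t : ℝ => t • (ξ : E3)) =ᶠ[𝓝 1] fun _ => F ξ := by
    filter_upwards [lt_mem_nhds one_pos] with t ht
    exact radialExt_smul_coe F ht ξ
  exact h3.unique ((hasDerivAt_const (1 : ℝ) (F ξ)).congr_of_eventuallyEq h4)

/-- `surfGrad` is the derivative within the cone evaluated at `x/|x|`, and unique differentiability
makes that derivative `C¹` up to the boundary. -/
theorem contDiffOn_radialExt_surfGrad {H : S2 → ℝ}
    (hH : ContDiffOn ℝ 2 (radialExt H) (cone (closure R.Γ))) (j : Fin 3) :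
    ContDiffOn ℝ 1 (radialExt fun η => surfGrad (closure R.Γ) H η j) (cone (closure R.Γ)) := by
  have h1 : ContDiffOn ℝ 1 (fun x => fderivWithin ℝ (radialExt H) (cone (closure R.Γ)) x
      (EuclideanSpace.single j 1)) (cone (closure R.Γ)) :=
    (hH.fderivWithin R.uniqueDiffOn_cone_closure (m := 1) (by norm_num)).clm_apply contDiffOn_const
  have h2 := h1.comp ((contDiffOn_coe_radialProj 1).mono fun x hx => hx.1)
    fun _ (hx : _ ∈ cone (closure R.Γ)) => coe_mem_cone_iff.2 hx.2
  exact h2.congr fun x _ => surfGrad_apply _ _ _ _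

/-- By homogeneity, the radial extension of `(∇*H)_j` is `|x|` times the `j`-th partial derivative.
Differentiating `|x|` adds `ξ_j (∇*H)_j`, which sums to `ξ · ∇*H = 0`; the second derivatives sum to
the Laplacian. -/
theorem surfDiv_surfGrad {H : S2 → ℝ}
    (hH : ContDiffOn ℝ 2 (radialExt H) (cone (closure R.Γ))) {ξ : S2} (hξ : ξ ∈ R.Γ) :
    surfDiv (closure R.Γ) (surfGrad (closure R.Γ) H) ξ = beltrami (closure R.Γ) H ξ := by
  set C := cone (closure R.Γ) with hC
  have hmem : (ξ : E3) ∈ cone R.Γ := coe_mem_cone_iff.2 hξ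
  have hmemC : (ξ : E3) ∈ C := R.cone_subset_cone_closure hmem
  have hD : DifferentiableAt ℝ (fderivWithin ℝ (radialExt H) C) (ξ : E3) :=
    ((hH.fderivWithin R.uniqueDiffOn_cone_closure (m := 1) (by norm_num)).differentiableOn
      one_ne_zero).differentiableAt (R.cone_closure_mem_nhds hmem)
  have hterm : ∀ j, surfGrad (closure R.Γ) (fun η => surfGrad (closure R.Γ) H η j) ξ j =
      (ξ : E3) j * surfGrad (closure R.Γ) H ξ j +
      fderivWithin ℝ (fderivWithin ℝ (radialExt H) C) C ξ (EuclideanSpace.single j 1)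
        (EuclideanSpace.single j 1) := by
    intro j
    have he : (radialExt fun η => surfGrad (closure R.Γ) H η j) =ᶠ[𝓝 (ξ : E3)] fun x =>
        ‖x‖ * fderivWithin ℝ (radialExt H) C x (EuclideanSpace.single j 1) := by
      filter_upwards [R.isOpen_cone.mem_nhds hmem] with x hx
      have hn : 0 < ‖x‖ := norm_pos_iff.2 hx.1
      have hmem' : (radialProj x : E3) ∈ cone R.Γ := coe_mem_cone_iff.2 hx.2
      rw [radialExt, surfGrad_apply, fderivWithin_eq hmem', fderivWithin_eq hx,
        fderiv_radialExt_smul H (inv_pos.2 hn) x, ← coe_radialProj hx.1]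
      simp
      field_simp
    have h1 := (hasFDerivAt_norm_coe ξ).fun_mul
      (hD.hasFDerivAt.clm_apply (hasFDerivAt_const (EuclideanSpace.single j (1 : ℝ)) (ξ : E3)))
    rw [surfGrad_apply, fderivWithin_eq hmem, he.fderiv_eq, h1.fderiv, surfGrad_apply,
      fderivWithin_eq (g := fderivWithin ℝ (radialExt H) C) hmem]
    simp [EuclideanSpace.inner_single_right]
    ring
  have hrad := inner_coe_surfGrad (hH.of_le (by norm_num)) hξ
  rw [inner_eq] at hrad
  rw [beltrami, InnerProductSpace.laplacianWithin_eq_iteratedFDerivWithin_orthonormalBasis _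
    R.uniqueDiffOn_cone_closure hmemC (EuclideanSpace.basisFun (Fin 3) ℝ)]
  simp only [surfDiv, hterm, Finset.sum_add_distrib,
    iteratedFDerivWithin_two_apply _ R.uniqueDiffOn_cone_closure hmemC]
  rw [Fin.sum_univ_three, hrad]
  simp [hC]

/-- Green's first formula for the Beltrami operator. -/
theorem integral_mul_beltrami {F H : S2 → ℝ}
    (hF : ContDiffOn ℝ 1 (radialExt F) (cone (closure R.Γ)))
    (hH : ContDiffOn ℝ 2 (radialExt H) (cone (closure R.Γ))) :
    ∫ η in R.Γ, F η * beltrami (closure R.Γ) H η ∂surfaceMeasure =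
      (∫ η in frontier R.Γ, F η * R.normalDeriv H η ∂(R.lineMeasure)) -
        ∫ η in R.Γ, inner ℝ (surfGrad (closure R.Γ) H η) (surfGrad (closure R.Γ) F η)
          ∂surfaceMeasure := by
  -- Green's formula with `f = ∇*H`; the term with the factor `2` vanishes because `∇*H` is
  -- tangential.
  have h := integral_inner_surfGrad_add hF (contDiffOn_radialExt_surfGrad hH)
  rw [setIntegral_congr_fun R.isOpen.measurableSet (f := fun η =>
      F η * surfDiv (closure R.Γ) (surfGrad (closure R.Γ) H) η) (g := fun η =>
      F η * beltrami (closure R.Γ) H η) fun ξ hξ => by simp only [surfDiv_surfGrad hH hξ],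
    setIntegral_eq_zero_of_forall_eq_zero (f := fun η : S2 => inner ℝ (η : E3)
      (F η • surfGrad (closure R.Γ) H η)) fun ξ hξ => by
        rw [inner_smul_right, inner_coe_surfGrad (hH.of_le (by norm_num)) hξ, mul_zero]] at h
  simp only [inner_smul_right] at h
  simp only [normalDeriv]
  linarith

end RegularRegion

end Spherical

theorem mainTheorem9 (R : Spherical.RegularRegion) :
    -- (a)
    (∀ f : S2 → E3, Spherical.IsVecCk 1 (closure R.Γ) f →
      (∀ ξ ∈ closure R.Γ, inner ℝ (ξ : E3) (f ξ) = 0) →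
      (∫ η in R.Γ, Spherical.surfDiv (closure R.Γ) f η ∂Spherical.surfaceMeasure
          = ∫ η in frontier R.Γ, inner ℝ (R.normal η) (f η) ∂(R.lineMeasure)) ∧
      (∫ η in R.Γ, Spherical.surfCurl (closure R.Γ) f η ∂Spherical.surfaceMeasure
          = ∫ η in frontier R.Γ, inner ℝ (R.tangent η) (f η) ∂(R.lineMeasure))) ∧
    -- (b)
    (∀ (F : S2 → ℝ) (f : S2 → E3), Spherical.IsCk 1 (closure R.Γ) F →
      Spherical.IsVecCk 1 (closure R.Γ) f →
      ((∫ η in R.Γ, inner ℝ (f η) (Spherical.surfGrad (closure R.Γ) F η)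
            ∂Spherical.surfaceMeasure)
          + (∫ η in R.Γ, F η * Spherical.surfDiv (closure R.Γ) f η ∂Spherical.surfaceMeasure)
        = (∫ η in frontier R.Γ, inner ℝ (R.normal η) (F η • f η) ∂(R.lineMeasure))
          + 2 * ∫ η in R.Γ, inner ℝ (η : E3) (F η • f η) ∂Spherical.surfaceMeasure) ∧
      ((∫ η in R.Γ, inner ℝ (f η) (Spherical.surfCurlGrad (closure R.Γ) F η)
            ∂Spherical.surfaceMeasure)
          + (∫ η in R.Γ, F η * Spherical.surfCurl (closure R.Γ) f η ∂Spherical.surfaceMeasure)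
        = ∫ η in frontier R.Γ, inner ℝ (R.tangent η) (F η • f η) ∂(R.lineMeasure))) ∧
    -- (c)
    (∀ F H : S2 → ℝ, Spherical.IsCk 2 (closure R.Γ) F → Spherical.IsCk 2 (closure R.Γ) H →
      (∫ η in R.Γ, F η * Spherical.beltrami (closure R.Γ) H η ∂Spherical.surfaceMeasure)
          - (∫ η in R.Γ, H η * Spherical.beltrami (closure R.Γ) F η ∂Spherical.surfaceMeasure)
        = (∫ η in frontier R.Γ, F η * R.normalDeriv H η ∂(R.lineMeasure))
          - ∫ η in frontier R.Γ, H η * R.normalDeriv F η ∂(R.lineMeasure)) := by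
  refine ⟨fun f hf ht => ⟨?_, ?_⟩, fun F f hF hf => ⟨?_, ?_⟩, fun F H hF hH => ?_⟩
  · rw [Spherical.RegularRegion.integral_surfDiv_eq hf.contDiffOn_radialExt,
      setIntegral_eq_zero_of_forall_eq_zero fun ξ hξ => ht ξ (subset_closure hξ), mul_zero, add_zero]
  · exact Spherical.RegularRegion.integral_surfCurl_eq hf.contDiffOn_radialExt
  · exact Spherical.RegularRegion.integral_inner_surfGrad_add hF.contDiffOn_radialExt
      hf.contDiffOn_radialExt
  · exact Spherical.RegularRegion.integral_inner_surfCurlGrad_add hF.contDiffOn_radialExt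
      hf.contDiffOn_radialExt
  · have hF' := hF.contDiffOn_radialExt
    have hH' := hH.contDiffOn_radialExt
    rw [Spherical.RegularRegion.integral_mul_beltrami (hF'.of_le (by norm_num)) hH',
      Spherical.RegularRegion.integral_mul_beltrami (hH'.of_le (by norm_num)) hF']
    -- The integrals of `∇*F · ∇*H` are symmetric in `F` and `H` and cancel.
    simp only [real_inner_comm]
    ring
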